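/- Let $V$ be a non-zero complex vector space of finite dimension $n$, and let $K\subseteq V\wedge V$ be a subspace. Let $K^\perp\subseteq V^*\wedge V^*=(V\wedge V)^*$ be the space of functionals vanishing on $K$. The resonance variety of $(V,K)$ is $$\mathcal R(V,K)=\{a\in V^*\mid \exists\, b\in V^*,\ a\wedge b\neq 0,\ a\wedge b\in K^\perp\}\cup\{0\}.$$ Let $S=\mathrm{Sym}(V)$. The Koszul module $\mathcal W(V,K)$ is the cokernel of the $S$-linear map $$\delta_3+\mathrm{id}\otimes\iota:\ S\otimes_{\mathbb C}\big(\textstyle\bigwedge^3V\oplus K\big)\to S\otimes_{\mathbb C}\textstyle\bigwedge^2V,$$ where $\iota:K\to V\wedge V$ is the inclusion and $\delta_3(v_1\wedge v_2\wedge v_3)=v_1\otimes (v_2\wedge v_3)-v_2\otimes (v_1\wedge v_3)+v_3\otimes (v_1\wedge v_2)$. It is graded; its $q$-th graded piece $\mathcal W_q(V,K)$ is the image of $\mathrm{Sym}^q(V)\otimes\bigwedge^2V$. **Theorem.** Let $n\ge 1$ and $0\le m\le\binom n2$ be integers. For every complex vector space $V$ of dimension $n$, the set $$U_{n,m}=\{K\in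 \mathrm{Grass}_m(V\wedge V)\mid \mathcal R(V,K)=\{0\}\}$$ is Zariski open in the Grassmannian $\mathrm{Grass}_m(V\wedge V)$ of $m$-dimensional subspaces of $V\wedge V$, and it is non-empty if and only if $m\ge 2n-3$. If $m\ge 2n-3$, then there is an integer $q=q(n,m)\ge 0$, depending only on $n$ and $m$, such that $\mathcal W_q(V,K)=0$ for every $V$ of dimension $n$ and every $K\in U_{n,m}$. -/

import Mathlib

open scoped TensorProduct LinearAlgebra.Projectivization

universe u

noncomputable section

namespace KoszulResonance

/-! ### Zariski topology on projective space and on the Grassmannian -/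

section Grassmannian

variable (W : Type u) [AddCommGroup W] [Module ℂ W]

/-- The polynomial function on `W` given by a polynomial in the linear functionals on `W`. -/
def polyEval {W : Type u} [AddCommGroup W] [Module ℂ W]
    (f : MvPolynomial (Module.Dual ℂ W) ℂ) (w : W) : ℂ :=
  MvPolynomial.eval (fun φ : Module.Dual ℂ W => φ w) f

/-- The common zero locus in `ℙ(W)` of a set of polynomials (to be used for homogeneous ones,
whose vanishing does not depend on the representative). -/
def zeroLocus (F : Set (MvPolynomial (Module.Dual ℂ W) ℂ)) : Set (ℙ ℂ W) :=
  {x | ∀ f ∈ F, polyEval f x.rep = 0}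

/-- A subset of `ℙ(W)` is algebraic if it is the common zero locus of a set of homogeneous
polynomials. -/
def IsAlgebraicSet (Z : Set (ℙ ℂ W)) : Prop :=
  ∃ F : Set (MvPolynomial (Module.Dual ℂ W) ℂ),
    (∀ f ∈ F, ∃ d : ℕ, f.IsHomogeneous d) ∧ Z = zeroLocus W F

/-- The Zariski topology on `ℙ(W)`: the closed sets are the algebraic sets. -/
@[reducible]
def zariskiTopology : TopologicalSpace (ℙ ℂ W) :=
  TopologicalSpace.ofClosed {Z | IsAlgebraicSet W Z}
    ⟨{1}, by
      rintro f rfl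
      exact ⟨0, MvPolynomial.isHomogeneous_one _ _⟩, by
      ext x
      simp [zeroLocus, polyEval]⟩
    (by
      intro A hA
      refine ⟨{f | (∃ d : ℕ, f.IsHomogeneous d) ∧ ∃ Z ∈ A, ∀ x ∈ Z, polyEval f x.rep = 0},
        fun f hf => hf.1, ?_⟩
      ext x
      constructor
      · rintro hx f ⟨-, Z, hZ, hf⟩
        exact hf x (hx Z hZ)
      · intro hx Z hZ
        obtain ⟨F, hF, rfl⟩ := hA hZ
        intro f hf
        exact hx f ⟨hF f hf, _, hZ, fun y hy => hy f hf⟩)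
    (by
      rintro _ ⟨F, hF, rfl⟩ _ ⟨G, hG, rfl⟩
      refine ⟨{h | ∃ f ∈ F, ∃ g ∈ G, h = f * g}, ?_, ?_⟩
      · rintro _ ⟨f, hf, g, hg, rfl⟩
        obtain ⟨d, hd⟩ := hF f hf
        obtain ⟨e, he⟩ := hG g hg
        exact ⟨d + e, hd.mul he⟩
      · ext x
        constructor
        · rintro (hx | hx) _ ⟨f, hf, g, hg, rfl⟩
          · have := hx f hf
            simp only [polyEval] at this ⊢
            simp [this]
          · have := hx g hg
            simp only [polyEval] at this ⊢
            simp [this]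
        · intro hx
          by_contra hcon
          simp only [Set.mem_union, zeroLocus, Set.mem_ofPred_eq, not_or, not_forall] at hcon
          obtain ⟨⟨f, hf, hf0⟩, ⟨g, hg, hg0⟩⟩ := hcon
          have := hx (f * g) ⟨f, hf, g, hg, rfl⟩
          simp only [polyEval, map_mul, mul_eq_zero] at this hf0 hg0
          tauto)

/-- The Grassmannian of `m`-planes, that is, of `m`-dimensional subspaces of `W`. -/
def Grass (m : ℕ) : Type u :=
  {K : Submodule ℂ W // Module.Finite ℂ K ∧ Module.finrank ℂ K = m}

variable {W} {m : ℕ}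

/-- The `m`-plane as a subspace of `W`. -/
def Grass.plane (K : Grass W m) : Submodule ℂ W := K.1

/-- A basis of an `m`-plane, indexed by `Fin m`. -/
def Grass.basis (K : Grass W m) : Module.Basis (Fin m) ℂ K.plane :=
  haveI : Module.Finite ℂ K.plane := K.2.1
  Module.finBasisOfFinrankEq ℂ K.plane K.2.2

/-- The multivector `v₁ ∧ ⋯ ∧ vₘ` of a basis `v₁, …, vₘ` of an `m`-plane. -/
def Grass.multivector (K : Grass W m) : ⋀[ℂ]^m W :=
  exteriorPower.ιMulti ℂ m (fun i => (K.basis i : W))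

theorem Grass.multivector_ne_zero (K : Grass W m) : K.multivector ≠ 0 := by
  obtain ⟨φ, hφ⟩ := LinearMap.exists_leftInverse_of_injective K.plane.subtype
    (Submodule.ker_subtype _)
  have hφ' : ∀ x : K.plane, φ (x : W) = x := fun x => LinearMap.congr_fun hφ x
  intro h0
  have h1 := exteriorPower.alternatingMapLinearEquiv_apply_ιMulti
    (K.basis.det.compLinearMap φ) (fun i => (K.basis i : W))
  rw [Grass.multivector] at h0
  rw [h0, map_zero, AlternatingMap.compLinearMap_apply] at h1
  simp only [hφ'] at h1
  exact zero_ne_one (h1.trans K.basis.det_self)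

/-- The Plücker embedding `K = ⟨v₁, …, vₘ⟩ ↦ [v₁ ∧ ⋯ ∧ vₘ]`. -/
def Grass.plucker (K : Grass W m) : ℙ ℂ (⋀[ℂ]^m W) :=
  Projectivization.mk ℂ K.multivector K.multivector_ne_zero

/-- The Zariski topology on the Grassmannian, as a subspace of projective space through the
Plücker embedding. -/
instance Grass.instTopologicalSpace : TopologicalSpace (Grass W m) :=
  TopologicalSpace.induced Grass.plucker (zariskiTopology (⋀[ℂ]^m W))

end Grassmannian

variable (V : Type u) [AddCommGroup V] [Module ℂ V]

/-! ### Resonance varieties -/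

section Resonance

/-- The wedge product `a ∧ b ∈ V* ∧ V*` of two functionals. -/
def wedge {V : Type u} [AddCommGroup V] [Module ℂ V] (a b : Module.Dual ℂ V) :
    ⋀[ℂ]^2 (Module.Dual ℂ V) :=
  exteriorPower.ιMulti ℂ 2 ![a, b]

/-- The orthogonal complement `K^⊥ ⊆ V* ∧ V*`: the elements that vanish on `K` as functionals on
`V ∧ V`, through the pairing `⟨a ∧ b, v ∧ w⟩ = a(v) b(w) - a(w) b(v)`. -/
def perp (K : Submodule ℂ (⋀[ℂ]^2 V)) : Submodule ℂ (⋀[ℂ]^2 (Module.Dual ℂ V)) :=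
  K.dualAnnihilator.comap (exteriorPower.pairingDual ℂ V 2)

/-- The resonance variety `R(V, K) ⊆ V*`. -/
def resonance (K : Submodule ℂ (⋀[ℂ]^2 V)) : Set (Module.Dual ℂ V) :=
  {a | ∃ b : Module.Dual ℂ V, wedge a b ≠ 0 ∧ wedge a b ∈ perp V K} ∪ {0}

/-- The set `U_{n,m}` of `m`-planes `K ⊆ V ∧ V` with `R(V, K) = {0}`, where `n = dim V`. -/
def vanishingLocus (m : ℕ) : Set (Grass (⋀[ℂ]^2 V) m) :=
  {K | resonance V K.plane = {0}}

end Resonance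

/-! ### Koszul modules -/

section Koszul

/-- The terms `Sym(V) ⊗ ⋀^p V` of the Koszul complex. -/
abbrev KoszulTerm (p : ℕ) : Type u :=
  SymmetricAlgebra ℂ V ⊗[ℂ] ⋀[ℂ]^p V

/-- The `ℂ`-linear map `V → Alt^p(V; Sym(V) ⊗ ⋀^p V)`, `v ↦ ((v₁, …, v_p) ↦ v ⊗ v₁ ∧ ⋯ ∧ v_p)`. -/
def koszulAux (p : ℕ) : V →ₗ[ℂ] V [⋀^Fin p]→ₗ[ℂ] KoszulTerm V p where
  toFun v := (TensorProduct.mk ℂ (SymmetricAlgebra ℂ V) (⋀[ℂ]^p V)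
    (SymmetricAlgebra.ι ℂ V v)).compAlternatingMap (exteriorPower.ιMulti ℂ p)
  map_add' v w := by
    ext x
    simp
  map_smul' c v := by
    ext x
    simp [TensorProduct.smul_tmul']

/-- The Koszul differential `δ_{p+1} : Sym(V) ⊗ ⋀^{p+1} V → Sym(V) ⊗ ⋀^p V`, the `Sym(V)`-linear
map sending `1 ⊗ v₀ ∧ ⋯ ∧ v_p` to `∑ j, (-1)^j v_j ⊗ (v₀ ∧ ⋯ ∧ v̂_j ∧ ⋯ ∧ v_p)`. -/
def koszulDifferential (p : ℕ) :
    KoszulTerm V (p + 1) →ₗ[SymmetricAlgebra ℂ V] KoszulTerm V p :=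
  LinearMap.liftBaseChange (SymmetricAlgebra ℂ V)
    (exteriorPower.alternatingMapLinearEquiv
      (AlternatingMap.alternatizeUncurryFin (koszulAux V p)))

theorem koszulDifferential_ιMulti (p : ℕ) (v : Fin (p + 1) → V) :
    koszulDifferential V p (1 ⊗ₜ exteriorPower.ιMulti ℂ (p + 1) v) =
      ∑ j : Fin (p + 1), (-1 : ℤ) ^ (j : ℕ) •
        (SymmetricAlgebra.ι ℂ V (v j) ⊗ₜ[ℂ] exteriorPower.ιMulti ℂ p (j.removeNth v)) := by
  simp [koszulDifferential, AlternatingMap.alternatizeUncurryFin_apply, koszulAux]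

/-- The presentation map `δ₃ + id ⊗ ι` of the Koszul module. -/
def koszulPresentation (K : Submodule ℂ (⋀[ℂ]^2 V)) :
    (KoszulTerm V 3 × (SymmetricAlgebra ℂ V ⊗[ℂ] K)) →ₗ[SymmetricAlgebra ℂ V] KoszulTerm V 2 :=
  (koszulDifferential V 2).coprod (K.subtype.baseChange (SymmetricAlgebra ℂ V))

/-- The Koszul module `W(V, K)`, the cokernel of `δ₃ + id ⊗ ι`. -/
abbrev KoszulModule (K : Submodule ℂ (⋀[ℂ]^2 V)) : Type u :=
  KoszulTerm V 2 ⧸ LinearMap.range (koszulPresentation V K)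

/-- The symmetric power `Sym^q(V) ⊆ Sym(V)`, the span of the products of `q` elements of `V`. -/
def symPower (q : ℕ) : Submodule ℂ (SymmetricAlgebra ℂ V) :=
  (LinearMap.range (SymmetricAlgebra.ι ℂ V)) ^ q

/-- The graded piece `W_q(V, K)`, the image of `Sym^q(V) ⊗ (V ∧ V)` in `W(V, K)`. -/
def koszulPiece (K : Submodule ℂ (⋀[ℂ]^2 V)) (q : ℕ) : Submodule ℂ (KoszulModule V K) :=
  (LinearMap.range ((symPower V q).subtype.rTensor (⋀[ℂ]^2 V))).map
    ((LinearMap.range (koszulPresentation V K)).mkQ.restrictScalars ℂ)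

end Koszul

end KoszulResonance

end

noncomputable section

/-! Regard a functional `a` on `V` as a point of the spectrum of `Sym(V)`. For `a ≠ 0` the dual of
the fibre of the Koszul module at `a` consists of the forms `f` on `V ∧ V` that vanish on `K` and
satisfy `a ∧ f = 0`; such an `f` is some `a ∧ b`. Hence the resonance is trivial iff the Koszul
module is supported at the origin, and by Nakayama and the Nullstellensatz this means that some
`W_q` vanishes (`exists_koszulPiece_eq_bot`, `resonance_eq_of_koszulPiece_eq_bot`).

For fixed `q`, the condition `W_q = 0` says that certain vectors, linear in the Plücker coordinates
of `K`, span a fixed finite-dimensional space. This is the non-vanishing of some maximal minor, so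
it is open. `U_{n,m}` is the increasing union of these loci, hence open; the Grassmannian is
Noetherian, so one `q` serves for all of it, and transport to a model of `V` makes `q` depend on `n`
and `m` only.

Trivial resonance also means that `K^⊥` meets the cone of decomposable forms, of dimension `2n - 3`
for `n ≥ 2`, only in zero. In its coordinate ring a chain of Schubert primes gives the irrelevant
ideal height at least `2n - 3`, while the `m` equations from a basis of `K` cut out the origin
alone, so Krull's theorem bounds this height by `m`. Conversely, the sums of `e_i ∧ e_j` along the
`2n - 3` antidiagonals already force trivial resonance, which persists when `K` grows. -/

theorem exists_algHom_ker_eq {A : Type*} [CommRing A] [Algebra ℂ A] [Algebra.FiniteType ℂ A]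
    (I : Ideal A) [I.IsMaximal] : ∃ φ : A →ₐ[ℂ] ℂ, RingHom.ker φ = I := by
  let := Ideal.Quotient.field I
  have : Algebra.FiniteType ℂ (A ⧸ I) := inferInstance
  have hfin : Module.Finite ℂ (A ⧸ I) := finite_of_finite_type_of_isJacobsonRing ℂ (A ⧸ I)
  have hbij : Function.Bijective (algebraMap ℂ (A ⧸ I)) :=
    IsAlgClosed.algebraMap_bijective_of_isIntegral
  let e : ℂ ≃ₐ[ℂ] (A ⧸ I) := AlgEquiv.ofBijective (Algebra.ofId ℂ (A ⧸ I)) hbij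
  refine ⟨e.symm.toAlgHom.comp (Ideal.Quotient.mkₐ ℂ I), ?_⟩
  ext x
  simp [RingHom.mem_ker, Ideal.Quotient.eq_zero_iff_mem]

namespace KoszulResonance

variable {V : Type u} [AddCommGroup V] [Module ℂ V]

/-! ### Decomposable forms and trivial resonance -/

section Pairing

theorem pairing_wedge (a b : Module.Dual ℂ V) (v : Fin 2 → V) :
    exteriorPower.pairingDual ℂ V 2 (wedge a b) (exteriorPower.ιMulti ℂ 2 v) =
      a (v 0) * b (v 1) - a (v 1) * b (v 0) := by
  rw [wedge, exteriorPower.pairingDual_ιMulti_ιMulti, Matrix.det_fin_two]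
  simp
  ring

theorem wedge_self (a : Module.Dual ℂ V) : wedge a a = 0 :=
  (exteriorPower.ιMulti ℂ 2).map_eq_zero_of_eq ![a, a] (i := 0) (j := 1) rfl (by decide)

theorem wedge_zero_left (b : Module.Dual ℂ V) : wedge 0 b = 0 :=
  (exteriorPower.ιMulti ℂ 2).map_coord_zero (i := 0) rfl

theorem update_pair_one {M : Type*} (x y z : M) : Function.update ![x, y] 1 z = ![x, z] := by
  ext i
  fin_cases i <;> rfl

theorem wedge_smul_right (a b : Module.Dual ℂ V) (c : ℂ) : wedge a (c • b) = c • wedge a b := by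
  have := (exteriorPower.ιMulti ℂ 2).map_update_smul ![a, b] 1 c b
  rwa [update_pair_one, update_pair_one] at this

/-- At an `x` with `a x ≠ 0` the equations make `b` a multiple of `a`. This avoids any appeal to
injectivity of the pairing, hence to finite dimension. -/
theorem wedge_eq_zero_of_forall {a b : Module.Dual ℂ V}
    (h : ∀ v w, a v * b w - a w * b v = 0) : wedge a b = 0 := by
  by_cases ha : a = 0
  · rw [ha, wedge_zero_left]
  obtain ⟨x, hx⟩ : ∃ x, a x ≠ 0 := by
    by_contra! hcon
    exact ha (LinearMap.ext hcon)
  have hb : b = ((a x)⁻¹ * b x) • a := by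
    ext w
    have := h x w
    simp only [LinearMap.smul_apply, smul_eq_mul]
    field_simp
    linear_combination this
  rw [hb, wedge_smul_right, wedge_self, smul_zero]

theorem mem_perp_iff {K : Submodule ℂ (⋀[ℂ]^2 V)} {x : ⋀[ℂ]^2 (Module.Dual ℂ V)} :
    x ∈ perp V K ↔ ∀ k ∈ K, exteriorPower.pairingDual ℂ V 2 x k = 0 := by
  simp [perp, Submodule.mem_dualAnnihilator]

theorem resonance_eq_singleton_iff {K : Submodule ℂ (⋀[ℂ]^2 V)} :
    resonance V K = {0} ↔ ∀ a b : Module.Dual ℂ V, wedge a b ∈ perp V K → wedge a b = 0 := by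
  constructor
  · intro h a b hab
    by_contra hne
    have ha : a ∈ resonance V K := Or.inl ⟨b, hne, hab⟩
    rw [h] at ha
    rw [Set.mem_singleton_iff.mp ha, wedge_zero_left] at hne
    exact hne rfl
  · intro h
    refine Set.eq_singleton_iff_unique_mem.mpr ⟨Or.inr rfl, ?_⟩
    rintro a (⟨b, hne, hab⟩ | ha)
    · exact absurd (h a b hab) hne
    · exact ha

/-- A functional on `V ∧ V` that factors through a decomposable form `a ∧ b` and vanishes on `K`
is zero if the resonance variety is trivial. -/
theorem eq_zero_of_resonance_eq {K : Submodule ℂ (⋀[ℂ]^2 V)} (hK : resonance V K = {0})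
    (f : Module.Dual ℂ (⋀[ℂ]^2 V)) (hf : ∀ k ∈ K, f k = 0) (a b : Module.Dual ℂ V)
    (hab : ∀ v, f (exteriorPower.ιMulti ℂ 2 v) = a (v 0) * b (v 1) - a (v 1) * b (v 0)) :
    f = 0 := by
  have hfe : f = exteriorPower.pairingDual ℂ V 2 (wedge a b) := by
    refine exteriorPower.linearMap_ext (AlternatingMap.ext fun v => ?_)
    simp only [LinearMap.compAlternatingMap_apply]
    rw [hab, pairing_wedge]
  have h0 := resonance_eq_singleton_iff.mp hK a b (mem_perp_iff.mpr fun k hk => hfe ▸ hf k hk)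
  rw [hfe, h0, map_zero]

theorem resonance_mono {K L : Submodule ℂ (⋀[ℂ]^2 V)} (hKL : K ≤ L)
    (hK : resonance V K = {0}) : resonance V L = {0} :=
  resonance_eq_singleton_iff.mpr fun a b hab => resonance_eq_singleton_iff.mp hK a b
    (mem_perp_iff.mpr fun k hk => mem_perp_iff.mp hab k (hKL hk))

/-- The bilinear form `(v, w) ↦ f (v ∧ w)`, in the second variable. -/
def contractLeft (f : Module.Dual ℂ (⋀[ℂ]^2 V)) (v : V) : Module.Dual ℂ V where
  toFun w := f (exteriorPower.ιMulti ℂ 2 ![v, w])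
  map_add' x y := by
    have := (exteriorPower.ιMulti ℂ 2).map_update_add ![v, 0] 1 x y
    rw [update_pair_one, update_pair_one, update_pair_one] at this
    rw [this, map_add]
  map_smul' c x := by
    have := (exteriorPower.ιMulti ℂ 2).map_update_smul ![v, 0] 1 c x
    rw [update_pair_one, update_pair_one] at this
    rw [this, map_smul, RingHom.id_apply]

theorem contractLeft_apply (f : Module.Dual ℂ (⋀[ℂ]^2 V)) (v w : V) :
    contractLeft f v w = f (exteriorPower.ιMulti ℂ 2 ![v, w]) := rfl

end Pairing

/-! ### Vanishing of a graded piece forces trivial resonance -/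

section Koszul

theorem range_koszulPresentation (K : Submodule ℂ (⋀[ℂ]^2 V)) :
    LinearMap.range (koszulPresentation V K) = LinearMap.range (koszulDifferential V 2) ⊔
      LinearMap.range (K.subtype.baseChange (SymmetricAlgebra ℂ V)) :=
  LinearMap.range_coprod _ _

theorem one_tmul_mem_range_koszulPresentation {K : Submodule ℂ (⋀[ℂ]^2 V)} {k : ⋀[ℂ]^2 V}
    (hk : k ∈ K) (s : SymmetricAlgebra ℂ V) :
    s ⊗ₜ[ℂ] k ∈ LinearMap.range (koszulPresentation V K) := by
  rw [range_koszulPresentation]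
  exact Submodule.mem_sup_right ⟨s ⊗ₜ ⟨k, hk⟩, by simp⟩

theorem koszulPiece_eq_bot_iff {K : Submodule ℂ (⋀[ℂ]^2 V)} {q : ℕ} :
    koszulPiece V K q = ⊥ ↔ ∀ s ∈ symPower V q, ∀ w : ⋀[ℂ]^2 V,
      s ⊗ₜ[ℂ] w ∈ LinearMap.range (koszulPresentation V K) := by
  rw [koszulPiece, eq_bot_iff, Submodule.map_le_iff_le_comap]
  constructor
  · intro h s hs w
    have := h ⟨(⟨s, hs⟩ : symPower V q) ⊗ₜ w, rfl⟩
    simpa using this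
  · rintro h _ ⟨x, rfl⟩
    induction x using TensorProduct.induction_on with
    | zero => simp
    | tmul s w => simpa using h s s.2 w
    | add x y hx hy =>
      rw [map_add]
      exact add_mem hx hy

/-- `Sym(V)` is generated in degree one. The loci `W_q = 0` therefore increase with `q`, as the
compactness argument requires. -/
theorem koszulPiece_succ_eq_bot {K : Submodule ℂ (⋀[ℂ]^2 V)} {q : ℕ}
    (h : koszulPiece V K q = ⊥) : koszulPiece V K (q + 1) = ⊥ := by
  rw [koszulPiece_eq_bot_iff] at h ⊢
  intro s hs w
  rw [symPower, pow_succ'] at hs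
  induction hs using Submodule.mul_induction_on' with
  | mem_mul_mem x _ y hy =>
    have := Submodule.smul_mem (LinearMap.range (koszulPresentation V K)) x (h y hy w)
    simpa [TensorProduct.smul_tmul'] using this
  | add x _ y _ hx hy =>
    rw [TensorProduct.add_tmul]
    exact add_mem hx hy

theorem koszulDifferential_two (v : Fin 3 → V) :
    koszulDifferential V 2 (1 ⊗ₜ exteriorPower.ιMulti ℂ 3 v) =
      SymmetricAlgebra.ι ℂ V (v 0) ⊗ₜ[ℂ] exteriorPower.ιMulti ℂ 2 ![v 1, v 2] -
      SymmetricAlgebra.ι ℂ V (v 1) ⊗ₜ[ℂ] exteriorPower.ιMulti ℂ 2 ![v 0, v 2] +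
      SymmetricAlgebra.ι ℂ V (v 2) ⊗ₜ[ℂ] exteriorPower.ιMulti ℂ 2 ![v 0, v 1] := by
  have h0 : (0 : Fin 3).removeNth v = ![v 1, v 2] := by
    ext i; fin_cases i <;> rfl
  have h1 : (1 : Fin 3).removeNth v = ![v 0, v 2] := by
    ext i; fin_cases i <;> rfl
  have h2 : (2 : Fin 3).removeNth v = ![v 0, v 1] := by
    ext i; fin_cases i <;> rfl
  rw [koszulDifferential_ιMulti, Fin.sum_univ_three, h0, h1, h2]
  simp [sub_eq_add_neg]

/-- An element of the range of the presentation is detected on generators. -/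
theorem range_koszulPresentation_induction {K : Submodule ℂ (⋀[ℂ]^2 V)}
    {P : KoszulTerm V 2 → Prop} (h0 : P 0) (hadd : ∀ x y, P x → P y → P (x + y))
    (hd : ∀ (s : SymmetricAlgebra ℂ V) (v : Fin 3 → V),
      P (s • koszulDifferential V 2 (1 ⊗ₜ exteriorPower.ιMulti ℂ 3 v)))
    (hk : ∀ (s : SymmetricAlgebra ℂ V), ∀ k ∈ K, P (s ⊗ₜ k))
    {x : KoszulTerm V 2} (hx : x ∈ LinearMap.range (koszulPresentation V K)) : P x := by
  rw [range_koszulPresentation] at hx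
  obtain ⟨_, ⟨y, rfl⟩, _, ⟨z, rfl⟩, rfl⟩ := Submodule.mem_sup.mp hx
  clear hx
  refine hadd _ _ ?_ ?_
  · induction y using TensorProduct.induction_on with
    | zero => simpa using h0
    | add x y hx hy => 
      rw [map_add]
      exact hadd _ _ hx hy
    | tmul s w =>
      have hw : w ∈ Submodule.span ℂ (Set.range (exteriorPower.ιMulti ℂ 3 (M := V))) := by
        rw [exteriorPower.ιMulti_span]; trivial
      induction hw using Submodule.span_induction generalizing s with
      | mem x h =>
        obtain ⟨v, rfl⟩ := h
        have := hd s v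
        rwa [← map_smul, TensorProduct.smul_tmul', smul_eq_mul, mul_one] at this
      | zero => simpa using h0
      | add x y _ _ hx hy =>
        rw [TensorProduct.tmul_add, map_add]
        exact hadd _ _ (hx s) (hy s)
      | smul c x _ hx =>
        rw [← TensorProduct.smul_tmul]
        exact hx _
  · induction z using TensorProduct.induction_on with
    | zero => simpa using h0
    | add x y hx hy => rw [map_add]; exact hadd _ _ hx hy
    | tmul s w => simpa using hk s w w.2

/-- The evaluation `s ⊗ w ↦ s(a) f(w)`. -/
def evalTensor (a : Module.Dual ℂ V) (f : Module.Dual ℂ (⋀[ℂ]^2 V)) : KoszulTerm V 2 →ₗ[ℂ] ℂ :=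
  TensorProduct.lift ((LinearMap.mul ℂ ℂ).compl₁₂ (SymmetricAlgebra.lift a).toLinearMap f)

@[simp]
theorem evalTensor_tmul (a : Module.Dual ℂ V) (f : Module.Dual ℂ (⋀[ℂ]^2 V))
    (s : SymmetricAlgebra ℂ V) (w : ⋀[ℂ]^2 V) :
    evalTensor a f (s ⊗ₜ w) = SymmetricAlgebra.lift a s * f w := by
  simp [evalTensor]

theorem evalTensor_smul (a : Module.Dual ℂ V) (f : Module.Dual ℂ (⋀[ℂ]^2 V))
    (s : SymmetricAlgebra ℂ V) (x : KoszulTerm V 2) :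
    evalTensor a f (s • x) = SymmetricAlgebra.lift a s * evalTensor a f x := by
  induction x using TensorProduct.induction_on with
  | zero => simp
  | tmul t w => simp [TensorProduct.smul_tmul', mul_assoc]
  | add x y hx hy => rw [smul_add, map_add, map_add, hx, hy, mul_add]

/-- If `a ∧ b` vanishes on `K`, evaluation at `a` paired with `a ∧ b` kills all relations. Applied
to `x ^ q ⊗ (v ∧ w)` it gives `a(x) ^ q` times the value of `a ∧ b` on `v ∧ w`, so `a(x) ≠ 0` forces
`a ∧ b = 0`. -/
theorem resonance_eq_of_koszulPiece_eq_bot {K : Submodule ℂ (⋀[ℂ]^2 V)} {q : ℕ}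
    (h : koszulPiece V K q = ⊥) : resonance V K = {0} := by
  rw [koszulPiece_eq_bot_iff] at h
  refine resonance_eq_singleton_iff.mpr fun a b hab => ?_
  rw [mem_perp_iff] at hab
  by_cases ha : a = 0
  · rw [ha, wedge_zero_left]
  obtain ⟨x, hx⟩ : ∃ x, a x ≠ 0 := by
    by_contra! hcon
    exact ha (LinearMap.ext hcon)
  have hker : ∀ y ∈ LinearMap.range (koszulPresentation V K),
      evalTensor a (exteriorPower.pairingDual ℂ V 2 (wedge a b)) y = 0 := by
    intro y hy
    refine range_koszulPresentation_induction (P := fun y => evalTensor a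
      (exteriorPower.pairingDual ℂ V 2 (wedge a b)) y = 0) (map_zero _)
      (fun x y hx hy => by rw [map_add, hx, hy, add_zero]) (fun s v => ?_)
      (fun s k hk => by rw [evalTensor_tmul, hab k hk, mul_zero]) hy
    -- The Koszul relations evaluate to the values of `a ∧ a ∧ b`, which is zero.
    · rw [evalTensor_smul, koszulDifferential_two]
      simp only [map_add, map_sub, evalTensor_tmul, pairing_wedge, SymmetricAlgebra.lift_ι_apply,
        Matrix.cons_val_zero, Matrix.cons_val_one]
      ring
  refine wedge_eq_zero_of_forall fun v w => ?_
  have hmem : SymmetricAlgebra.ι ℂ V x ^ q ∈ symPower V q :=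
    Submodule.pow_mem_pow _ (LinearMap.mem_range_self _ x) q
  have := hker _ (h _ hmem (exteriorPower.ιMulti ℂ 2 ![v, w]))
  rw [evalTensor_tmul, pairing_wedge] at this
  simpa [hx] using this

end Koszul

/-! ### Trivial resonance makes the Koszul module vanish in some degree -/

section Nullstellensatz

instance finiteType_symmetricAlgebra [FiniteDimensional ℂ V] :
    Algebra.FiniteType ℂ (SymmetricAlgebra ℂ V) :=
  Algebra.FiniteType.equiv inferInstance
    (SymmetricAlgebra.equivMvPolynomial (Module.finBasis ℂ V)).symm

/-- At a nonzero point `a` outside of the resonance variety, `V ∧ V` is spanned by `K` and the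
contractions by `a`. -/
theorem dual_eq_zero_of_contraction {K : Submodule ℂ (⋀[ℂ]^2 V)} (hK : resonance V K = {0})
    {a : Module.Dual ℂ V} (ha : a ≠ 0) (f : Module.Dual ℂ (⋀[ℂ]^2 V)) (hf : ∀ k ∈ K, f k = 0)
    (hfa : ∀ v : Fin 3 → V, a (v 0) * f (exteriorPower.ιMulti ℂ 2 ![v 1, v 2]) -
      a (v 1) * f (exteriorPower.ιMulti ℂ 2 ![v 0, v 2]) +
      a (v 2) * f (exteriorPower.ιMulti ℂ 2 ![v 0, v 1]) = 0) : f = 0 := by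
  obtain ⟨x, hx⟩ : ∃ x, a x ≠ 0 := by
    by_contra! hcon
    exact ha (LinearMap.ext hcon)
  refine eq_zero_of_resonance_eq hK f hf a ((a x)⁻¹ • contractLeft f x) fun v => ?_
  have := hfa ![x, v 0, v 1]
  have hv : v = ![v 0, v 1] := by ext i; fin_cases i <;> rfl
  simp only [Matrix.cons_val] at this
  rw [← hv] at this
  simp only [LinearMap.smul_apply, contractLeft_apply, smul_eq_mul]
  field_simp
  linear_combination this

variable [FiniteDimensional ℂ V]

/-- The fibre of the Koszul module at `a` is zero, so by Nakayama some `r` with value 1 at `a`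
annihilates the module. -/
theorem exists_smul_mem_range {K : Submodule ℂ (⋀[ℂ]^2 V)} (hK : resonance V K = {0})
    {a : Module.Dual ℂ V} (ha : a ≠ 0) :
    ∃ r : SymmetricAlgebra ℂ V, SymmetricAlgebra.lift a r = 1 ∧
      ∀ x : KoszulTerm V 2, r • x ∈ LinearMap.range (koszulPresentation V K) := by
  set I : Ideal (SymmetricAlgebra ℂ V) := RingHom.ker (SymmetricAlgebra.lift a) with hI
  set N := LinearMap.range (koszulPresentation V K) with hN
  have hfib : Submodule.comap (TensorProduct.mk ℂ (SymmetricAlgebra ℂ V) (⋀[ℂ]^2 V) 1)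
      ((N ⊔ I • ⊤).restrictScalars ℂ) = ⊤ := by
    by_contra hne
    obtain ⟨w, hw⟩ : ∃ w, w ∉ Submodule.comap (TensorProduct.mk ℂ (SymmetricAlgebra ℂ V)
        (⋀[ℂ]^2 V) 1) ((N ⊔ I • ⊤).restrictScalars ℂ) := by
      by_contra! hcon
      exact hne (eq_top_iff.mpr fun w _ => hcon w)
    obtain ⟨f, hfw, hf⟩ := Submodule.exists_le_ker_of_notMem hw
    -- Modulo `I`, an element `s` of `Sym(V)` acts as the scalar `s(a)`.
    have hmod : ∀ (s : SymmetricAlgebra ℂ V) (w : ⋀[ℂ]^2 V),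
        s ⊗ₜ[ℂ] w - (1 : SymmetricAlgebra ℂ V) ⊗ₜ[ℂ] ((SymmetricAlgebra.lift a s) • w) ∈
          I • (⊤ : Submodule (SymmetricAlgebra ℂ V) (KoszulTerm V 2)) := by
      intro s w
      have h1 : s - algebraMap ℂ (SymmetricAlgebra ℂ V) (SymmetricAlgebra.lift a s) ∈ I := by
        simp [hI, RingHom.mem_ker]
      have h2 := Submodule.smul_mem_smul h1
        (Submodule.mem_top (R := SymmetricAlgebra ℂ V)
          (x := (1 : SymmetricAlgebra ℂ V) ⊗ₜ[ℂ] w))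
      rwa [TensorProduct.smul_tmul', smul_eq_mul, mul_one, TensorProduct.sub_tmul,
        Algebra.algebraMap_eq_smul_one, TensorProduct.smul_tmul] at h2
    refine hfw ?_
    rw [dual_eq_zero_of_contraction hK ha f, LinearMap.zero_apply]
    · intro k hk
      refine hf ?_
      exact Submodule.mem_sup_left (one_tmul_mem_range_koszulPresentation hk 1)
    · intro v
      have hd : koszulDifferential V 2 (1 ⊗ₜ exteriorPower.ιMulti ℂ 3 v) ∈ N := by
        rw [hN, range_koszulPresentation]
        exact Submodule.mem_sup_left ⟨_, rfl⟩
      rw [koszulDifferential_two] at hd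
      have hm := fun i w => hmod (SymmetricAlgebra.ι ℂ V (v i)) w
      have key := Submodule.sub_mem _ (Submodule.mem_sup_left (T := I • ⊤) hd)
        (Submodule.mem_sup_right (S := N) (add_mem (sub_mem
          (hm 0 (exteriorPower.ιMulti ℂ 2 ![v 1, v 2]))
          (hm 1 (exteriorPower.ιMulti ℂ 2 ![v 0, v 2])))
          (hm 2 (exteriorPower.ιMulti ℂ 2 ![v 0, v 1]))))
      have h3 : (a (v 0) • exteriorPower.ιMulti ℂ 2 ![v 1, v 2] -
          a (v 1) • exteriorPower.ιMulti ℂ 2 ![v 0, v 2] +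
          a (v 2) • exteriorPower.ιMulti ℂ 2 ![v 0, v 1]) ∈ LinearMap.ker f := by
        refine hf ?_
        simp only [Submodule.mem_comap, TensorProduct.mk_apply, Submodule.restrictScalars_mem]
        convert key using 1
        simp only [SymmetricAlgebra.lift_ι_apply, TensorProduct.tmul_add, TensorProduct.tmul_sub]
        abel
      simpa using h3
  have htop : (⊤ : Submodule (SymmetricAlgebra ℂ V) (KoszulTerm V 2)) ≤ N ⊔ I • ⊤ := by
    intro x _
    induction x using TensorProduct.induction_on with
    | zero => exact zero_mem _
    | add x y hx hy => exact add_mem (hx trivial) (hy trivial)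
    | tmul s w =>
      have hw : w ∈ Submodule.comap (TensorProduct.mk ℂ (SymmetricAlgebra ℂ V) (⋀[ℂ]^2 V) 1)
        ((N ⊔ I • ⊤).restrictScalars ℂ) := hfib ▸ Submodule.mem_top
      have := Submodule.smul_mem (N ⊔ I • ⊤) s (x := (1 : SymmetricAlgebra ℂ V) ⊗ₜ[ℂ] w) hw
      rwa [TensorProduct.smul_tmul', smul_eq_mul, mul_one] at this
  obtain ⟨r, hr, hrN⟩ := Submodule.exists_sub_one_mem_and_smul_le_of_fg_of_le_sup
    (Module.Finite.fg_top (R := SymmetricAlgebra ℂ V) (M := KoszulTerm V 2)) le_rfl htop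
  refine ⟨r, ?_, fun x => hrN (Submodule.smul_mem_pointwise_smul x r _ trivial)⟩
  rw [hI, RingHom.mem_ker, map_sub, map_one, sub_eq_zero] at hr
  exact hr

/-- Maximal ideals over the annihilator `J` are points `a`, and a nonzero `a` is excluded by an `r ∈
J` with `r(a) = 1`. So the ideal generated by `V` lies in the radical of `J`, and a power of it lies
in `J`. -/
theorem exists_koszulPiece_eq_bot {K : Submodule ℂ (⋀[ℂ]^2 V)} (hK : resonance V K = {0}) :
    ∃ q, koszulPiece V K q = ⊥ := by
  have : IsNoetherianRing (SymmetricAlgebra ℂ V) := Algebra.FiniteType.isNoetherianRing ℂ _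
  have : IsJacobsonRing (SymmetricAlgebra ℂ V) := isJacobsonRing_of_finiteType (A := ℂ)
  set J := Module.annihilator (SymmetricAlgebra ℂ V) (KoszulModule V K) with hJ
  have hle : Ideal.span (Set.range (SymmetricAlgebra.ι ℂ V)) ≤ J.radical := by
    rw [Ideal.radical_eq_jacobson, Ideal.jacobson]
    refine le_sInf ?_
    rintro P ⟨hJP, hP⟩
    obtain ⟨φ, rfl⟩ := exists_algHom_ker_eq P
    obtain ⟨a, rfl⟩ := SymmetricAlgebra.lift.surjective φ
    rw [Ideal.span_le]
    rintro _ ⟨v, rfl⟩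
    by_cases ha : a = 0
    · simp [ha, RingHom.mem_ker]
    · exfalso
      obtain ⟨r, hr1, hr⟩ := exists_smul_mem_range hK ha
      have hrJ : r ∈ J := by
        rw [hJ, Module.mem_annihilator]
        intro x
        obtain ⟨x, rfl⟩ := Submodule.mkQ_surjective _ x
        rw [← map_smul, Submodule.mkQ_apply, Submodule.Quotient.mk_eq_zero]
        exact hr x
      have := hJP hrJ
      rw [RingHom.mem_ker, hr1] at this
      exact one_ne_zero this
  obtain ⟨q, hq⟩ := Ideal.exists_pow_le_of_le_radical_of_fg hle (IsNoetherian.noetherian _)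
  refine ⟨q, koszulPiece_eq_bot_iff.mpr fun s hs w => ?_⟩
  have hsq : ∀ q, ∀ s ∈ symPower V q,
      s ∈ Ideal.span (Set.range (SymmetricAlgebra.ι ℂ V)) ^ q := by
    intro q
    induction q with
    | zero => simp
    | succ q ih =>
      intro s hs
      rw [symPower, pow_succ] at hs
      rw [pow_succ]
      induction hs using Submodule.mul_induction_on' with
      | mem_mul_mem x hx y hy =>
        exact Ideal.mul_mem_mul (ih x hx) (Ideal.subset_span hy)
      | add x _ y _ hx hy => exact add_mem hx hy
  have hsJ := hq (hsq q s hs)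
  rw [hJ, Module.mem_annihilator] at hsJ
  have := hsJ (Submodule.mkQ _ ((1 : SymmetricAlgebra ℂ V) ⊗ₜ[ℂ] w))
  rwa [← map_smul, Submodule.mkQ_apply, Submodule.Quotient.mk_eq_zero,
    TensorProduct.smul_tmul', smul_eq_mul, mul_one] at this

end Nullstellensatz

end KoszulResonance

namespace KoszulResonance

/-! ### Spanning is a Zariski open condition -/

section SpanCondition

variable {W : Type u} [AddCommGroup W] [Module ℂ W]

/-- A spanning family, possibly infinite, contains a basis; reindexed by `κ`, it has invertible
determinant. -/
theorem exists_basis_det_ne_zero_iff {A ι κ : Type*} [AddCommGroup A] [Module ℂ A] [Fintype κ]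
    [DecidableEq κ] (b : Module.Basis κ ℂ A) (v : ι → A) :
    Submodule.span ℂ (Set.range v) = ⊤ ↔ ∃ s : κ → ι, b.det (v ∘ s) ≠ 0 := by
  constructor
  · intro h
    obtain ⟨τ, a, -, hspan, hli⟩ := exists_linearIndependent' ℂ v
    let c : Module.Basis τ ℂ A := Module.Basis.mk hli (by rw [hspan, h])
    let e : κ ≃ τ := b.indexEquiv c
    refine ⟨a ∘ e, ?_⟩
    have hv : v ∘ (a ∘ e) = c.reindex e.symm := by
      ext i
      simp [c]
    rw [hv]
    exact (b.isUnit_det (c.reindex e.symm)).ne_zero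
  · rintro ⟨s, hs⟩
    have := (b.is_basis_iff_det (v := v ∘ s)).mpr (isUnit_iff_ne_zero.mpr hs)
    refine top_unique (this.2.symm.le.trans (Submodule.span_mono ?_))
    exact Set.range_comp_subset_range s v

theorem isOpen_setOf_span_eq_top {A ι : Type*} [AddCommGroup A] [Module ℂ A]
    [FiniteDimensional ℂ A] (T : ι → W →ₗ[ℂ] A) :
    @IsOpen _ (zariskiTopology W)
      {x : ℙ ℂ W | Submodule.span ℂ (Set.range fun i => T i x.rep) = ⊤} := by
  let b := Module.finBasis ℂ A
  -- Each variable is a functional on `W`, so a matrix entry that is linear in the point is a single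
  -- variable and the minor is homogeneous.
  let P : (Fin (Module.finrank ℂ A) → ι) → MvPolynomial (Module.Dual ℂ W) ℂ := fun s =>
    (Matrix.of fun i j => MvPolynomial.X (b.coord i ∘ₗ T (s j))).det
  have hP : ∀ s w, polyEval (P s) w = b.det ((fun i => T i w) ∘ s) := by
    intro s w
    simp only [polyEval, P]
    rw [RingHom.map_det, Module.Basis.det_apply]
    congr 1
    ext i j
    simp [Module.Basis.toMatrix_apply]
  change _ᶜ ∈ {Z | IsAlgebraicSet W Z}
  refine ⟨Set.range P, ?_, ?_⟩
  · rintro _ ⟨s, rfl⟩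
    refine ⟨Module.finrank ℂ A, ?_⟩
    simp only [P, Matrix.det_apply]
    refine MvPolynomial.IsHomogeneous.sum _ _ _ fun σ _ => ?_
    have hprod : (∏ i, (Matrix.of fun i j =>
        (MvPolynomial.X (b.coord i ∘ₗ T (s j)) : MvPolynomial (Module.Dual ℂ W) ℂ))
        (σ i) i).IsHomogeneous (Module.finrank ℂ A) := by
      have := MvPolynomial.IsHomogeneous.prod Finset.univ (fun i => (Matrix.of fun i j =>
        (MvPolynomial.X (b.coord i ∘ₗ T (s j)) : MvPolynomial (Module.Dual ℂ W) ℂ)) (σ i) i)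
        (fun _ => 1) (fun i _ => MvPolynomial.isHomogeneous_X _ _)
      simpa using this
    rcases Int.units_eq_one_or (Equiv.Perm.sign σ) with h | h
    · rwa [h, one_smul]
    · rw [h, Units.neg_smul, one_smul]
      exact hprod.neg
  · ext x
    simp only [Set.mem_compl_iff, Set.mem_ofPred_eq, exists_basis_det_ne_zero_iff b, zeroLocus,
      Set.forall_mem_range, hP, not_exists, not_not]

theorem isOpen_setOf_le_span_multivector {B ι : Type*} [AddCommGroup B] [Module ℂ B]
    {m : ℕ} (E : Submodule ℂ B) [FiniteDimensional ℂ E] (T : ι → ⋀[ℂ]^m W →ₗ[ℂ] B)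
    (hT : ∀ i x, T i x ∈ E) :
    IsOpen {K : Grass W m | E ≤ Submodule.span ℂ (Set.range fun i => T i K.multivector)} := by
  refine ⟨_, isOpen_setOf_span_eq_top fun i => (T i).codRestrict E (hT i), ?_⟩
  ext K
  -- The chosen representative of the Plücker point differs from the multivector by a unit `c`,
  -- which does not change the span.
  obtain ⟨c, hc⟩ := Projectivization.exists_smul_eq_mk_rep ℂ K.multivector K.multivector_ne_zero
  change _ ↔ E ≤ _
  rw [Set.mem_preimage, Set.mem_ofPred_eq, Grass.plucker, ← hc]
  have himage : (Submodule.span ℂ (Set.range fun i => (T i).codRestrict E (hT i)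
      (c • K.multivector))).map E.subtype =
      Submodule.span ℂ (Set.range fun i => T i K.multivector) := by
    rw [Submodule.map_span, ← Set.range_comp]
    refine le_antisymm (Submodule.span_le.mpr ?_) (Submodule.span_le.mpr ?_)
    · rintro _ ⟨i, rfl⟩
      have : T i K.multivector ∈ Submodule.span ℂ (Set.range fun i => T i K.multivector) :=
        Submodule.subset_span ⟨i, rfl⟩
      simpa using Submodule.smul_mem _ (c : ℂ) this
    · rintro _ ⟨i, rfl⟩
      have := Submodule.smul_mem _ ((c⁻¹ : ℂˣ) : ℂ) (Submodule.subset_span (R := ℂ)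
        (Set.mem_range_self (f := E.subtype ∘ fun i => (T i).codRestrict E (hT i)
          (c • K.multivector)) i))
      have h2 : ((c⁻¹ : ℂˣ) : ℂ) • T i (c • K.multivector) = T i K.multivector := by
        rw [Units.smul_def, map_smul, smul_smul, Units.inv_mul, one_smul]
      simpa [h2] using this
  rw [← himage]
  constructor
  · intro h
    rw [h, Submodule.map_top, Submodule.range_subtype]
  · intro h
    refine eq_top_iff.mpr fun x _ => ?_
    obtain ⟨y, hy, hyx⟩ := h x.2
    rwa [← Subtype.ext hyx]

end SpanCondition

/-! ### Recovering a plane from its Plücker multivector -/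

section Contraction

variable {W : Type u} [AddCommGroup W] [Module ℂ W]

/-- The alternating form `(w₁, …, w_m) ↦ det (φ_j (w_i))` multiplied by a vector. -/
def contractionAux {m : ℕ} (φ : Fin m → Module.Dual ℂ W) : W →ₗ[ℂ] W [⋀^Fin m]→ₗ[ℂ] W where
  toFun v := (LinearMap.toSpanSingleton ℂ W v ∘ₗ exteriorPower.pairingDual ℂ W m
    (exteriorPower.ιMulti ℂ m φ)).compAlternatingMap (exteriorPower.ιMulti ℂ m)
  map_add' v w := by
    ext x
    simp
  map_smul' c v := by
    ext x
    simpa using smul_comm _ _ _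

/-- The contraction of a multivector by `m` functionals. -/
def contraction {m : ℕ} (φ : Fin m → Module.Dual ℂ W) : ⋀[ℂ]^(m + 1) W →ₗ[ℂ] W :=
  exteriorPower.alternatingMapLinearEquiv
    (AlternatingMap.alternatizeUncurryFin (contractionAux φ))

theorem contraction_ιMulti {m : ℕ} (φ : Fin m → Module.Dual ℂ W) (v : Fin (m + 1) → W) :
    contraction φ (exteriorPower.ιMulti ℂ (m + 1) v) =
      ∑ i : Fin (m + 1), (-1 : ℤ) ^ (i : ℕ) •
        ((Matrix.of fun k l => φ l (i.removeNth v k)).det • v i) := by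
  simp [contraction, AlternatingMap.alternatizeUncurryFin_apply, contractionAux]

/-- Contractions of `v₀ ∧ ⋯ ∧ v_m` are combinations of the `v_i`, and contracting with the dual
basis minus its `j`-th member returns `± v_j`. So `K` is spanned by vectors linear in its Plücker
coordinates. -/
theorem span_contraction {m : ℕ} (K : Grass W (m + 1)) :
    Submodule.span ℂ (Set.range fun φ : Fin m → Module.Dual ℂ W =>
      contraction φ K.multivector) = K.plane := by
  refine le_antisymm (Submodule.span_le.mpr ?_) ?_
  · rintro _ ⟨φ, rfl⟩
    simp only [Grass.multivector, contraction_ιMulti]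
    exact sum_mem fun i _ => zsmul_mem (Submodule.smul_mem _ _ (K.basis i).2) _
  · obtain ⟨p, hp⟩ := LinearMap.exists_leftInverse_of_injective K.plane.subtype
      (Submodule.ker_subtype _)
    have hp' : ∀ x : K.plane, p (x : W) = x := fun x => LinearMap.congr_fun hp x
    let ψ : Fin (m + 1) → Module.Dual ℂ W := fun i => K.basis.coord i ∘ₗ p
    have hψ : ∀ i j, ψ i (K.basis j) = if j = i then 1 else 0 := by
      intro i j
      simp [ψ, hp', Finsupp.single_apply]
    have hmem : ∀ j, (K.basis j : W) ∈ Submodule.span ℂ (Set.range fun φ :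
        Fin m → Module.Dual ℂ W => contraction φ K.multivector) := by
      intro j
      have hc : contraction (j.removeNth ψ) K.multivector =
          (-1 : ℤ) ^ (j : ℕ) • (K.basis j : W) := by
        rw [Grass.multivector, contraction_ιMulti, Finset.sum_eq_single j]
        · have : (Matrix.of fun k l => j.removeNth ψ l
              (j.removeNth (fun i => (K.basis i : W)) k)) = (1 : Matrix (Fin m) (Fin m) ℂ) := by
            ext k l
            simp [Fin.removeNth, hψ, Matrix.one_apply]
          rw [this, Matrix.det_one, one_smul]
        · intro i _ hij
          -- For `i ≠ j` the vector `v_j` remains among the rows, but every remaining functional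
          -- kills it.
          obtain ⟨k, hk⟩ := Fin.exists_succAbove_eq hij.symm
          rw [Matrix.det_eq_zero_of_row_eq_zero k, zero_smul, smul_zero]
          intro l
          simp [Fin.removeNth, hk, hψ, (Fin.succAbove_ne j l).symm]
        · simp
      have h2 : (K.basis j : W) = (-1 : ℤ) ^ (j : ℕ) •
          contraction (j.removeNth ψ) K.multivector := by
        rw [hc, smul_smul, ← mul_pow]
        simp
      rw [h2]
      refine zsmul_mem ?_ _
      exact Submodule.subset_span ⟨_, rfl⟩
    intro x hx
    have hsum := congrArg Subtype.val (K.basis.sum_repr ⟨x, hx⟩)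
    simp only [AddSubmonoidClass.coe_finsetSum, Submodule.coe_smul] at hsum
    rw [← hsum]
    exact sum_mem fun i _ => Submodule.smul_mem _ _ (hmem i)

instance subsingleton_grass_zero : Subsingleton (Grass W 0) := by
  refine ⟨fun K L => Subtype.ext ?_⟩
  have h : ∀ K : Grass W 0, K.1 = ⊥ := by
    rintro ⟨K, h1, h2⟩
    exact Submodule.finrank_eq_zero.mp h2
  rw [h K, h L]

end Contraction

/-! ### Homogeneous components in `Sym(V)` -/

section Grading

variable {V : Type u} [AddCommGroup V] [Module ℂ V]

/-- The algebra map `Sym(V) → Sym(V)[t]`, `v ↦ v t`, that records the grading. -/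
def gradingHom : SymmetricAlgebra ℂ V →ₐ[ℂ] Polynomial (SymmetricAlgebra ℂ V) :=
  SymmetricAlgebra.lift
    ((Polynomial.monomial (R := SymmetricAlgebra ℂ V) 1).restrictScalars ℂ ∘ₗ
      SymmetricAlgebra.ι ℂ V)

theorem gradingHom_ι (v : V) : gradingHom (SymmetricAlgebra.ι ℂ V v) =
    Polynomial.monomial 1 (SymmetricAlgebra.ι ℂ V v) := by
  simp [gradingHom]

/-- The component of degree `q` of an element of `Sym(V)`. -/
def symComponent (q : ℕ) : SymmetricAlgebra ℂ V →ₗ[ℂ] SymmetricAlgebra ℂ V :=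
  (Polynomial.lcoeff (SymmetricAlgebra ℂ V) q).restrictScalars ℂ ∘ₗ gradingHom.toLinearMap

theorem symComponent_apply (q : ℕ) (s : SymmetricAlgebra ℂ V) :
    symComponent q s = (gradingHom s).coeff q := rfl

theorem symComponent_zero_mul_ι (s : SymmetricAlgebra ℂ V) (v : V) :
    symComponent 0 (s * SymmetricAlgebra.ι ℂ V v) = 0 := by
  simp [symComponent_apply, gradingHom_ι, Polynomial.mul_coeff_zero, Polynomial.coeff_monomial]

theorem symComponent_succ_mul_ι (q : ℕ) (s : SymmetricAlgebra ℂ V) (v : V) :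
    symComponent (q + 1) (s * SymmetricAlgebra.ι ℂ V v) =
      symComponent q s * SymmetricAlgebra.ι ℂ V v := by
  simp [symComponent_apply, gradingHom_ι, Polynomial.coeff_mul_monomial]

theorem symComponent_mem (q : ℕ) (s : SymmetricAlgebra ℂ V) :
    symComponent q s ∈ symPower V q := by
  induction s using SymmetricAlgebra.induction generalizing q with
  | algebraMap c =>
    rw [symComponent_apply, AlgHom.commutes, Polynomial.algebraMap_apply, Polynomial.coeff_C]
    split_ifs with h
    · rw [h, symPower, pow_zero]
      exact Submodule.algebraMap_mem c
    · exact zero_mem _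
  | ι v =>
    rw [symComponent_apply, gradingHom_ι, Polynomial.coeff_monomial]
    split_ifs with h
    · rw [← h, symPower, pow_one]
      exact LinearMap.mem_range_self _ v
    · exact zero_mem _
  | mul a b ha hb =>
    rw [symComponent_apply, map_mul, Polynomial.coeff_mul]
    refine sum_mem fun x hx => ?_
    rw [← Finset.HasAntidiagonal.mem_antidiagonal.mp hx, symPower, pow_add]
    exact Submodule.mul_mem_mul (ha _) (hb _)
  | add a b ha hb =>
    rw [map_add]
    exact add_mem (ha q) (hb q)

theorem gradingHom_of_mem {q : ℕ} {s : SymmetricAlgebra ℂ V} (hs : s ∈ symPower V q) :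
    gradingHom s = Polynomial.monomial q s := by
  induction q generalizing s with
  | zero =>
    rw [symPower, pow_zero] at hs
    obtain ⟨c, rfl⟩ := Submodule.mem_one.mp hs
    rw [AlgHom.commutes, Polynomial.algebraMap_apply, Polynomial.monomial_zero_left]
  | succ q ih =>
    rw [symPower, pow_succ] at hs
    induction hs using Submodule.mul_induction_on' with
    | mem_mul_mem x hx y hy =>
      obtain ⟨v, rfl⟩ := hy
      rw [map_mul, ih hx, gradingHom_ι, Polynomial.monomial_mul_monomial]
    | add x _ y _ hx hy => rw [map_add, hx, hy, map_add]

theorem symComponent_of_mem {q : ℕ} {s : SymmetricAlgebra ℂ V} (hs : s ∈ symPower V q) :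
    symComponent q s = s := by
  rw [symComponent_apply, gradingHom_of_mem hs, Polynomial.coeff_monomial_same]

/-- `δ₃` raises the symmetric degree by one: degree 0 receives nothing, and degree `q + 1` only sees
the degree `q` part of `s`. -/
theorem rTensor_symComponent_koszulDifferential_mem (q : ℕ) (s : SymmetricAlgebra ℂ V)
    (v : Fin 3 → V) :
    (symComponent q).rTensor (⋀[ℂ]^2 V)
      (s • koszulDifferential V 2 (1 ⊗ₜ exteriorPower.ιMulti ℂ 3 v)) ∈
      LinearMap.range (koszulDifferential V 2) := by
  cases q with
  | zero =>
    rw [koszulDifferential_two]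
    simp [smul_add, smul_sub, TensorProduct.smul_tmul', symComponent_zero_mul_ι]
  | succ q =>
    refine ⟨symComponent q s • (1 ⊗ₜ exteriorPower.ιMulti ℂ 3 v), ?_⟩
    rw [map_smul, koszulDifferential_two]
    simp [smul_add, smul_sub, TensorProduct.smul_tmul', symComponent_succ_mul_ι]

end Grading

/-! ### Openness of the vanishing locus -/

section Openness

variable {V : Type u} [AddCommGroup V] [Module ℂ V]

/-- The graded pieces of the cokernel of the Koszul differential `δ₃`. -/
def koszulCokerPiece (V : Type u) [AddCommGroup V] [Module ℂ V] (q : ℕ) :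
    Submodule ℂ (KoszulTerm V 2 ⧸ LinearMap.range (koszulDifferential V 2)) :=
  (LinearMap.range ((symPower V q).subtype.rTensor (⋀[ℂ]^2 V))).map
    ((LinearMap.range (koszulDifferential V 2)).mkQ.restrictScalars ℂ)

theorem mkQ_tmul_mem_koszulCokerPiece {q : ℕ} {s : SymmetricAlgebra ℂ V}
    (hs : s ∈ symPower V q) (w : ⋀[ℂ]^2 V) :
    (LinearMap.range (koszulDifferential V 2)).mkQ (s ⊗ₜ w) ∈ koszulCokerPiece V q :=
  ⟨s ⊗ₜ w, ⟨(⟨s, hs⟩ : symPower V q) ⊗ₜ w, rfl⟩, rfl⟩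

theorem koszulCokerPiece_le {q : ℕ}
    {N : Submodule ℂ (KoszulTerm V 2 ⧸ LinearMap.range (koszulDifferential V 2))}
    (h : ∀ s ∈ symPower V q, ∀ w,
      (LinearMap.range (koszulDifferential V 2)).mkQ (s ⊗ₜ w) ∈ N) :
    koszulCokerPiece V q ≤ N := by
  rw [koszulCokerPiece, Submodule.map_le_iff_le_comap]
  rintro _ ⟨x, rfl⟩
  induction x using TensorProduct.induction_on with
  | zero => simp
  | tmul s w => simpa using h s s.2 w
  | add x y hx hy =>
    rw [map_add]
    exact add_mem hx hy

instance finiteDimensional_symPower [FiniteDimensional ℂ V] (q : ℕ) :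
    FiniteDimensional ℂ (symPower V q) :=
  Module.Finite.iff_fg.mpr ((Module.Finite.fg_top.map (SymmetricAlgebra.ι ℂ V) |>
    fun h => by rwa [Submodule.map_top] at h : (LinearMap.range (SymmetricAlgebra.ι ℂ V)).FG).pow q)

instance finiteDimensional_koszulCokerPiece [FiniteDimensional ℂ V] (q : ℕ) :
    FiniteDimensional ℂ (koszulCokerPiece V q) := by
  unfold koszulCokerPiece
  infer_instance

/-- The linear map `k ↦ [t ⊗ c_φ(k)]`. -/
def contractionSymbol {m : ℕ} (t : SymmetricAlgebra ℂ V)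
    (φ : Fin m → Module.Dual ℂ (⋀[ℂ]^2 V)) : ⋀[ℂ]^(m + 1) (⋀[ℂ]^2 V) →ₗ[ℂ]
      KoszulTerm V 2 ⧸ LinearMap.range (koszulDifferential V 2) :=
  (LinearMap.range (koszulDifferential V 2)).mkQ.restrictScalars ℂ ∘ₗ
    TensorProduct.mk ℂ (SymmetricAlgebra ℂ V) (⋀[ℂ]^2 V) t ∘ₗ contraction φ

/-- The image of `δ₃` does not depend on `K`, so it is divided out first; what remains is a spanning
condition on vectors linear in the multivector. Taking degree `q` components reduces all relations
from `K` to those with coefficients in `Sym^q(V)`. -/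
theorem koszulPiece_eq_bot_iff_le_span {m q : ℕ} (K : Grass (⋀[ℂ]^2 V) (m + 1)) :
    koszulPiece V K.plane q = ⊥ ↔ koszulCokerPiece V q ≤ Submodule.span ℂ (Set.range
      fun x : symPower V q × (Fin m → Module.Dual ℂ (⋀[ℂ]^2 V)) =>
        contractionSymbol (x.1 : SymmetricAlgebra ℂ V) x.2 K.multivector) := by
  rw [koszulPiece_eq_bot_iff]
  set D := LinearMap.range (koszulDifferential V 2) with hD
  constructor
  · intro h
    refine koszulCokerPiece_le fun s hs w => ?_
    set N := Submodule.span ℂ (Set.range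
      fun x : symPower V q × (Fin m → Module.Dual ℂ (⋀[ℂ]^2 V)) =>
        contractionSymbol (x.1 : SymmetricAlgebra ℂ V) x.2 K.multivector) with hN
    have key : ∀ y ∈ LinearMap.range (koszulPresentation V K.plane),
        D.mkQ ((symComponent q).rTensor (⋀[ℂ]^2 V) y) ∈ N := by
      intro y hy
      refine range_koszulPresentation_induction (P := fun y =>
        D.mkQ ((symComponent q).rTensor (⋀[ℂ]^2 V) y) ∈ N) ?_ ?_ ?_ ?_ hy
      · simp
      · intro x y hx hy
        rw [map_add, map_add]
        exact add_mem hx hy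
      · intro s v
        have h0 : D.mkQ ((symComponent q).rTensor (⋀[ℂ]^2 V)
            (s • koszulDifferential V 2 (1 ⊗ₜ exteriorPower.ιMulti ℂ 3 v))) = 0 :=
          (Submodule.Quotient.mk_eq_zero D).mpr (rTensor_symComponent_koszulDifferential_mem q s v)
        rw [h0]
        exact zero_mem _
      · intro s k hk
        rw [LinearMap.rTensor_tmul]
        have hle : K.plane ≤ N.comap (D.mkQ.restrictScalars ℂ ∘ₗ
            TensorProduct.mk ℂ (SymmetricAlgebra ℂ V) (⋀[ℂ]^2 V) (symComponent q s)) := by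
          rw [← span_contraction, Submodule.span_le]
          rintro _ ⟨φ, rfl⟩
          exact Submodule.subset_span ⟨(⟨symComponent q s, symComponent_mem q s⟩, φ), rfl⟩
        exact hle hk
    have := key _ (h s hs w)
    rwa [LinearMap.rTensor_tmul, symComponent_of_mem hs] at this
  · intro h s hs w
    have hDle : D ≤ LinearMap.range (koszulPresentation V K.plane) := by
      rw [range_koszulPresentation]
      exact le_sup_left
    have hle : Submodule.span ℂ (Set.range
      fun x : symPower V q × (Fin m → Module.Dual ℂ (⋀[ℂ]^2 V)) =>
        contractionSymbol (x.1 : SymmetricAlgebra ℂ V) x.2 K.multivector) ≤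
        ((LinearMap.range (koszulPresentation V K.plane)).map D.mkQ).restrictScalars ℂ := by
      rw [Submodule.span_le]
      rintro _ ⟨⟨t, φ⟩, rfl⟩
      refine ⟨_, one_tmul_mem_range_koszulPresentation (k := contraction φ K.multivector) ?_
        (t : SymmetricAlgebra ℂ V), rfl⟩
      rw [← span_contraction]
      exact Submodule.subset_span ⟨φ, rfl⟩
    obtain ⟨y, hy, hyx⟩ := hle (h (mkQ_tmul_mem_koszulCokerPiece hs w))
    have := hDle ((Submodule.Quotient.eq D).mp hyx)
    simpa using sub_mem hy this

variable [FiniteDimensional ℂ V]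

theorem isOpen_setOf_koszulPiece_eq_bot (m q : ℕ) :
    IsOpen {K : Grass (⋀[ℂ]^2 V) m | koszulPiece V K.plane q = ⊥} := by
  cases m with
  -- Contraction needs at least one factor; for `m = 0` the Grassmannian has at most one point.
  | zero => exact isOpen_discrete _
  | succ m =>
    simp only [koszulPiece_eq_bot_iff_le_span]
    exact isOpen_setOf_le_span_multivector _ _ fun x k =>
      mkQ_tmul_mem_koszulCokerPiece x.1.2 _

theorem vanishingLocus_eq_iUnion (m : ℕ) :
    vanishingLocus V m = ⋃ q, {K | koszulPiece V K.plane q = ⊥} := by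
  ext K
  rw [Set.mem_iUnion]
  exact ⟨fun h => exists_koszulPiece_eq_bot h, fun ⟨q, hq⟩ =>
    resonance_eq_of_koszulPiece_eq_bot hq⟩

theorem isOpen_vanishingLocus (m : ℕ) : IsOpen (vanishingLocus V m) := by
  rw [vanishingLocus_eq_iUnion]
  exact isOpen_iUnion fun q => isOpen_setOf_koszulPiece_eq_bot m q

end Openness

end KoszulResonance

namespace KoszulResonance

/-! ### The Grassmannian is a Noetherian space -/

section Noetherian

variable {W : Type u} [AddCommGroup W] [Module ℂ W] [FiniteDimensional ℂ W]

/-- The polynomials in the coordinates that vanish on the chosen representatives of the points of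
a subset of `ℙ(W)`. -/
def coordVanishingIdeal (Z : Set (ℙ ℂ W)) :
    Ideal (MvPolynomial (Fin (Module.finrank ℂ W)) ℂ) :=
  ⨅ x ∈ Z, RingHom.ker (MvPolynomial.eval fun i => (Module.finBasis ℂ W).repr x.rep i)

theorem mem_coordVanishingIdeal {Z : Set (ℙ ℂ W)}
    {f : MvPolynomial (Fin (Module.finrank ℂ W)) ℂ} : f ∈ coordVanishingIdeal Z ↔
      ∀ x ∈ Z, MvPolynomial.eval (fun i => (Module.finBasis ℂ W).repr x.rep i) f = 0 := by
  simp [coordVanishingIdeal, Submodule.mem_iInf, RingHom.mem_ker]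

theorem coordVanishingIdeal_anti {Z Z' : Set (ℙ ℂ W)} (h : Z ⊆ Z') :
    coordVanishingIdeal Z' ≤ coordVanishingIdeal Z := fun _ hf =>
  mem_coordVanishingIdeal.mpr fun x hx => mem_coordVanishingIdeal.mp hf x (h hx)

theorem subset_of_coordVanishingIdeal_le {Z Z' : Set (ℙ ℂ W)} (hZ : IsAlgebraicSet W Z)
    (h : coordVanishingIdeal Z ≤ coordVanishingIdeal Z') : Z' ⊆ Z := by
  obtain ⟨F, -, rfl⟩ := hZ
  intro x hx f hf
  -- Homogeneous equations use one variable per functional; expanding these in a finite basis lands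
  -- in a polynomial ring to which Hilbert's basis theorem applies.
  let g : MvPolynomial (Fin (Module.finrank ℂ W)) ℂ :=
    MvPolynomial.aeval (fun φ : Module.Dual ℂ W =>
      ∑ i, MvPolynomial.C (φ (Module.finBasis ℂ W i)) * MvPolynomial.X i) f
  have hg : ∀ w : W, MvPolynomial.eval (fun i => (Module.finBasis ℂ W).repr w i) g =
      polyEval f w := by
    intro w
    simp only [g, polyEval, MvPolynomial.aeval_def]
    rw [← MvPolynomial.coe_eval₂Hom, ← RingHom.comp_apply]
    congr 1
    refine MvPolynomial.ringHom_ext (fun c => by simp) fun φ => ?_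
    conv_rhs => rw [MvPolynomial.eval_X, ← (Module.finBasis ℂ W).sum_repr w, map_sum]
    simp [mul_comm]
  have hgI : g ∈ coordVanishingIdeal (zeroLocus W F) :=
    mem_coordVanishingIdeal.mpr fun y hy => (hg y.rep).trans (hy f hf)
  rw [← hg]
  exact mem_coordVanishingIdeal.mp (h hgI) x hx

theorem noetherianSpace_zariski :
    @TopologicalSpace.NoetherianSpace (ℙ ℂ W) (zariskiTopology W) := by
  let _ : TopologicalSpace (ℙ ℂ W) := zariskiTopology W
  refine ((TopologicalSpace.noetherianSpace_TFAE (ℙ ℂ W)).out 0 1).mpr ?_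
  let I : TopologicalSpace.Closeds (ℙ ℂ W) →
      (Ideal (MvPolynomial (Fin (Module.finrank ℂ W)) ℂ))ᵒᵈ := fun Z =>
    OrderDual.toDual (coordVanishingIdeal (Z : Set (ℙ ℂ W)))
  have halg : ∀ Z : TopologicalSpace.Closeds (ℙ ℂ W), IsAlgebraicSet W (Z : Set (ℙ ℂ W)) := by
    intro Z
    have h := Z.isClosed.isOpen_compl
    change (Z : Set (ℙ ℂ W))ᶜᶜ ∈ {Z | IsAlgebraicSet W Z} at h
    rwa [compl_compl] at h
  have hI : StrictMono I := by
    intro Z Z' hlt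
    have hsub : (Z : Set (ℙ ℂ W)) ⊆ Z' := SetLike.coe_subset_coe.mpr hlt.le
    refine lt_of_le_not_ge (OrderDual.toDual_le_toDual.mpr (coordVanishingIdeal_anti hsub))
      fun hle => ?_
    have hsub' : (Z' : Set (ℙ ℂ W)) ⊆ Z :=
      subset_of_coordVanishingIdeal_le (halg Z) (OrderDual.toDual_le_toDual.mp hle)
    exact hlt.not_ge (SetLike.coe_subset_coe.mp hsub')
  exact hI.wellFoundedLT

instance noetherianSpace_grass (m : ℕ) : TopologicalSpace.NoetherianSpace (Grass W m) := by
  let _ : TopologicalSpace (ℙ ℂ (⋀[ℂ]^m W)) := zariskiTopology _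
  have := noetherianSpace_zariski (W := ⋀[ℂ]^m W)
  exact Topology.IsInducing.noetherianSpace (i := Grass.plucker) ⟨rfl⟩

end Noetherian

/-! ### A uniform degree of vanishing -/

section Uniform

variable {V V' : Type u} [AddCommGroup V] [Module ℂ V] [AddCommGroup V'] [Module ℂ V']

theorem exists_koszulPiece_eq_bot_on_vanishingLocus [FiniteDimensional ℂ V] (m : ℕ) :
    ∃ q, ∀ K ∈ vanishingLocus V m, koszulPiece V K.plane q = ⊥ := by
  obtain ⟨q, hq⟩ := (TopologicalSpace.NoetherianSpace.isCompact
    (vanishingLocus V m)).elim_directed_cover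
    (fun q => {K : Grass (⋀[ℂ]^2 V) m | koszulPiece V K.plane q = ⊥})
    (fun q => isOpen_setOf_koszulPiece_eq_bot m q) (vanishingLocus_eq_iUnion m).le
    (directed_of_isDirected_le (monotone_nat_of_le_succ fun q K hK =>
      koszulPiece_succ_eq_bot hK))
  exact ⟨q, hq⟩

theorem koszulPiece_map_eq_bot {f : V →ₗ[ℂ] V'} (hf : Function.Surjective f)
    {K : Submodule ℂ (⋀[ℂ]^2 V)} {q : ℕ} (h : koszulPiece V K q = ⊥) :
    koszulPiece V' (K.map (exteriorPower.map 2 f)) q = ⊥ := by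
  rw [koszulPiece_eq_bot_iff] at h ⊢
  set K' := K.map (exteriorPower.map 2 f) with hK'
  let σ : SymmetricAlgebra ℂ V →ₐ[ℂ] SymmetricAlgebra ℂ V' :=
    SymmetricAlgebra.lift (SymmetricAlgebra.ι ℂ V' ∘ₗ f)
  have hσ : ∀ v, σ (SymmetricAlgebra.ι ℂ V v) = SymmetricAlgebra.ι ℂ V' (f v) := by simp [σ]
  have hpair : ∀ x y, f ∘ ![x, y] = ![f x, f y] := by
    intro x y
    ext i
    fin_cases i <;> rfl
  let Φ : KoszulTerm V 2 →ₗ[ℂ] KoszulTerm V' 2 :=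
    TensorProduct.map σ.toLinearMap (exteriorPower.map 2 f)
  have hΦ : ∀ s w, Φ (s ⊗ₜ w) = σ s ⊗ₜ exteriorPower.map 2 f w := fun s w => rfl
  have hΦmem : ∀ y ∈ LinearMap.range (koszulPresentation V K),
      Φ y ∈ LinearMap.range (koszulPresentation V' K') := by
    intro y hy
    refine range_koszulPresentation_induction (P := fun y =>
      Φ y ∈ LinearMap.range (koszulPresentation V' K')) ?_ ?_ ?_ ?_ hy
    · simp
    · intro x y hx hy
      rw [map_add]
      exact add_mem hx hy
    · intro s v
      have hd : Φ (s • koszulDifferential V 2 (1 ⊗ₜ exteriorPower.ιMulti ℂ 3 v)) =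
          koszulDifferential V' 2 (σ s • 1 ⊗ₜ exteriorPower.ιMulti ℂ 3 (f ∘ v)) := by
        rw [map_smul (koszulDifferential V' 2), koszulDifferential_two, koszulDifferential_two]
        simp [smul_add, smul_sub, TensorProduct.smul_tmul', hΦ, hσ, hpair]
      rw [hd, range_koszulPresentation]
      exact Submodule.mem_sup_left (LinearMap.mem_range_self _ _)
    · intro s k hk
      exact one_tmul_mem_range_koszulPresentation (Submodule.mem_map_of_mem hk) _
  intro s' hs' w'
  have hmap : (symPower V q).map σ.toLinearMap = symPower V' q := by
    rw [symPower, symPower, Submodule.map_pow, ← LinearMap.range_comp]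
    congr 1
    have : σ.toLinearMap ∘ₗ SymmetricAlgebra.ι ℂ V = SymmetricAlgebra.ι ℂ V' ∘ₗ f :=
      LinearMap.ext hσ
    rw [this, LinearMap.range_comp_of_range_eq_top _ (LinearMap.range_eq_top.mpr hf)]
  rw [← hmap] at hs'
  obtain ⟨s, hs, rfl⟩ := hs'
  obtain ⟨w, rfl⟩ := exteriorPower.map_surjective hf w'
  exact hΦmem _ (h s hs w)

theorem exists_forall_koszulPiece_eq_bot (n m : ℕ) :
    ∃ q : ℕ, ∀ (V : Type u) [AddCommGroup V] [Module ℂ V] [FiniteDimensional ℂ V],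
      Module.finrank ℂ V = n → ∀ K ∈ vanishingLocus V m, koszulPiece V K.plane q = ⊥ := by
  obtain ⟨q, hq⟩ := exists_koszulPiece_eq_bot_on_vanishingLocus
    (V := ULift.{u} (Fin n → ℂ)) m
  refine ⟨q, fun V _ _ _ hV K hK => ?_⟩
  let e : V ≃ₗ[ℂ] ULift.{u} (Fin n → ℂ) := LinearEquiv.ofFinrankEq _ _ (by simp [hV])
  have hid : ∀ w : ⋀[ℂ]^2 V, exteriorPower.map 2 e.symm.toLinearMap
      (exteriorPower.map 2 e.toLinearMap w) = w := by
    intro w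
    rw [← LinearMap.comp_apply, ← exteriorPower.map_comp, LinearEquiv.symm_comp,
      exteriorPower.map_id, LinearMap.id_apply]
  have hinj : Function.Injective (exteriorPower.map 2 e.toLinearMap) :=
    Function.LeftInverse.injective hid
  let K₀ : Grass (⋀[ℂ]^2 (ULift.{u} (Fin n → ℂ))) m :=
    ⟨K.plane.map (exteriorPower.map 2 e.toLinearMap), by
      have := K.2.1
      exact ⟨inferInstance, (Submodule.equivMapOfInjective _ hinj K.plane).finrank_eq.symm.trans K.2.2⟩⟩
  -- Triviality of the resonance is transported through the vanishing of some `W_r`, which is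
  -- functorial for surjections.
  obtain ⟨r, hr⟩ := exists_koszulPiece_eq_bot hK
  have h₀ : K₀ ∈ vanishingLocus _ m :=
    resonance_eq_of_koszulPiece_eq_bot (koszulPiece_map_eq_bot e.surjective hr)
  have := koszulPiece_map_eq_bot (f := e.symm.toLinearMap) e.symm.surjective (hq K₀ h₀)
  have hK₀ : K₀.plane.map (exteriorPower.map 2 e.symm.toLinearMap) = K.plane := by
    change (K.plane.map _).map _ = _
    rw [← Submodule.map_comp, LinearMap.ext (f := _ ∘ₗ _) (g := LinearMap.id) hid,
      Submodule.map_id]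
  rwa [hK₀] at this

end Uniform

end KoszulResonance

namespace KoszulResonance

/-! ### Antidiagonal sums detect decomposable forms -/

section Antidiagonal

/-- The pairs of indices `i < j` with `i + j = s`. -/
def increasingPairs (n s : ℕ) : Finset (Fin n × Fin n) :=
  Finset.univ.filter fun p => p.1 < p.2 ∧ (p.1 : ℕ) + p.2 = s

/-- A decomposable form is zero as soon as the sums of its coordinates along the antidiagonals
are zero. -/
theorem minor_eq_zero_of_sum_antidiagonal {n : ℕ} {α β : Fin n → ℂ}
    (h : ∀ s : Fin (2 * n - 3),
      ∑ p ∈ increasingPairs n (s + 1), (α p.1 * β p.2 - α p.2 * β p.1) = 0) (i j : Fin n) :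
    α i * β j - α j * β i = 0 := by
  set c : Fin n → Fin n → ℂ := fun i j => α i * β j - α j * β i with hc
  have hanti : ∀ i j, c i j = - c j i := fun i j => by simp [hc]
  suffices hlt : ∀ i j, i < j → c i j = 0 by
    rcases lt_trichotomy i j with hij | rfl | hij
    · exact hlt i j hij
    · ring
    · exact (hanti i j).trans (by rw [hlt j i hij, neg_zero])
  by_contra! hcon
  obtain ⟨i₀, j₀, hij₀, hne₀⟩ := hcon
  -- Among the nonzero minors, take the largest upper index `p`, then the largest lower index `q`.
  -- It is the only nonzero term on its antidiagonal, a contradiction.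
  obtain ⟨⟨q, p⟩, hqp, hmax⟩ := Finset.exists_max_image
    (Finset.univ.filter fun x : Fin n × Fin n => x.1 < x.2 ∧ c x.1 x.2 ≠ 0)
    (fun x => toLex (x.2, x.1)) ⟨(i₀, j₀), by simp [hij₀, hne₀]⟩
  simp only [Finset.mem_filter, Finset.mem_univ, true_and] at hqp hmax
  obtain ⟨hlt, hne⟩ := hqp
  have hgt : ∀ i j, i < j → p < j → c i j = 0 := by
    intro i j hij hpj
    by_contra hcij
    have := hmax (i, j) ⟨hij, hcij⟩
    rw [Prod.Lex.toLex_le_toLex] at this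
    rcases this with h1 | ⟨h1, -⟩
    · exact absurd hpj h1.not_gt
    · exact absurd hpj h1.le.not_gt
  have heq : ∀ i, q < i → i < p → c i p = 0 := by
    intro i hqi hip
    by_contra hcip
    have := hmax (i, p) ⟨hip, hcip⟩
    rw [Prod.Lex.toLex_le_toLex] at this
    rcases this with h1 | ⟨-, h1⟩
    · exact lt_irrefl _ h1
    · exact absurd hqi h1.not_gt
  have hp := p.isLt
  have hlt' : (q : ℕ) < p := hlt
  have hsum := h ⟨q + p - 1, by omega⟩
  have hqp1 : (q : ℕ) + p - 1 + 1 = q + p := by omega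
  simp only [hqp1] at hsum
  rw [Finset.sum_eq_single (q, p)] at hsum
  · exact hne hsum
  · rintro ⟨i, j⟩ hij hijne
    simp only [increasingPairs, Finset.mem_filter, Finset.mem_univ, true_and] at hij
    obtain ⟨hij, hs⟩ := hij
    change c i j = 0
    have hij' : (i : ℕ) < j := hij
    rcases lt_trichotomy j p with hjp | rfl | hpj
    · have hjp' : (j : ℕ) < p := hjp
      have hqi : q < i := Fin.lt_def.mpr (by omega)
      have h1 := heq i hqi (hij.trans hjp)
      have h2 := heq j (hqi.trans hij) hjp
      -- A term with `j < p` has `i > q`. By maximality `c i p` and `c j p` vanish, and the Plücker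
      -- relation then kills `c i j`.
      have hplucker : c q p * c i j = c q j * c i p - c q i * c j p := by
        simp only [hc]
        ring
      rw [h1, h2, mul_zero, mul_zero, sub_zero, mul_eq_zero] at hplucker
      exact hplucker.resolve_left hne
    · have hiq : i = q := Fin.ext (Nat.add_right_cancel hs)
      rw [hiq] at hijne
      exact absurd rfl hijne
    · exact hgt i j hij hpj
  · intro hmem
    exact absurd (by simp [increasingPairs, hlt]) hmem

end Antidiagonal

/-! ### Planes with trivial resonance when `m ≥ 2n - 3` -/

section Existence

variable {V : Type u} [AddCommGroup V] [Module ℂ V]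

/-- The span of the vectors `∑ e_i ∧ e_j`, the sum over `i < j` with `i + j` fixed. -/
def antidiagonalPlane {n : ℕ} (e : Module.Basis (Fin n) ℂ V) : Submodule ℂ (⋀[ℂ]^2 V) :=
  Submodule.span ℂ (Set.range fun s : Fin (2 * n - 3) =>
    ∑ p ∈ increasingPairs n (s + 1), exteriorPower.ιMulti ℂ 2 ![e p.1, e p.2])

theorem finrank_antidiagonalPlane_le {n : ℕ} (e : Module.Basis (Fin n) ℂ V) :
    Module.finrank ℂ (antidiagonalPlane e) ≤ 2 * n - 3 :=
  (finrank_range_le_card _).trans (by simp)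

theorem resonance_antidiagonalPlane {n : ℕ} (e : Module.Basis (Fin n) ℂ V) :
    resonance V (antidiagonalPlane e) = {0} := by
  refine resonance_eq_singleton_iff.mpr fun a b hab => ?_
  rw [mem_perp_iff] at hab
  have hminor := minor_eq_zero_of_sum_antidiagonal (α := fun i => a (e i))
    (β := fun i => b (e i)) (fun s => by
      have := hab _ (Submodule.subset_span (Set.mem_range_self s))
      simpa [pairing_wedge] using this)
  have h1 : ∀ j v, a v * b (e j) - a (e j) * b v = 0 := by
    intro j v
    have : b (e j) • a - a (e j) • b = 0 := e.ext fun i => by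
      simpa [mul_comm] using hminor i j
    simpa [mul_comm] using LinearMap.congr_fun this v
  refine wedge_eq_zero_of_forall fun v w => ?_
  have : a v • b - b v • a = 0 := e.ext fun j => by
    simpa [mul_comm] using h1 j v
  simpa [mul_comm] using LinearMap.congr_fun this w

theorem exists_le_finrank_eq {W : Type*} [AddCommGroup W] [Module ℂ W] [FiniteDimensional ℂ W]
    (K : Submodule ℂ W) {m : ℕ} (hKm : Module.finrank ℂ K ≤ m)
    (hm : m ≤ Module.finrank ℂ W) :
    ∃ L : Submodule ℂ W, K ≤ L ∧ Module.finrank ℂ L = m := by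
  induction m, hKm using Nat.le_induction with
  | base => exact ⟨K, le_rfl, rfl⟩
  | succ m _ ih =>
    obtain ⟨L, hKL, hL⟩ := ih (by omega)
    obtain ⟨x, -, hx⟩ := SetLike.exists_of_lt (lt_top_iff_ne_top.mpr (show L ≠ ⊤ by
      rintro rfl
      rw [finrank_top] at hL
      omega))
    refine ⟨L ⊔ Submodule.span ℂ {x}, hKL.trans le_sup_left, ?_⟩
    have hdisj : L ⊓ Submodule.span ℂ {x} = ⊥ := by
      rw [← disjoint_iff, Submodule.disjoint_span_singleton]
      exact fun h => absurd h hx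
    have := Submodule.finrank_sup_add_finrank_inf_eq L (Submodule.span ℂ {x})
    rw [hdisj, finrank_bot, finrank_span_singleton
      (by rintro rfl; exact hx (zero_mem L))] at this
    omega

theorem vanishingLocus_nonempty [FiniteDimensional ℂ V] {m : ℕ}
    (hm : m ≤ (Module.finrank ℂ V).choose 2) (hm' : 2 * Module.finrank ℂ V - 3 ≤ m) :
    (vanishingLocus V m).Nonempty := by
  let e := Module.finBasis ℂ V
  obtain ⟨L, hKL, hL⟩ := exists_le_finrank_eq (antidiagonalPlane e) (m := m)
    ((finrank_antidiagonalPlane_le e).trans hm') (by rwa [exteriorPower.finrank_eq])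
  exact ⟨⟨L, inferInstance, hL⟩, resonance_mono hKL (resonance_antidiagonalPlane e)⟩

end Existence

end KoszulResonance

namespace KoszulResonance

/-! ### Necessity of `m ≥ 2n - 3` by Krull's height theorem -/

section PluckerAlgebra

variable {V : Type u} [AddCommGroup V] [Module ℂ V] {n : ℕ} (e : Module.Basis (Fin n) ℂ V)

/-- The generic functionals `∑ xᵢ eᵢ*` and `∑ yᵢ eᵢ*`, with the variables selected by `f`. -/
def genericForm (f : Fin n → Fin n ⊕ Fin n) : V →ₗ[ℂ] MvPolynomial (Fin n ⊕ Fin n) ℂ :=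
  e.constr ℂ fun i => MvPolynomial.X (f i)

theorem genericForm_basis (f : Fin n → Fin n ⊕ Fin n) (i : Fin n) :
    genericForm e f (e i) = MvPolynomial.X (f i) :=
  e.constr_basis ℂ _ i

/-- The map `v ↦ (w ↦ x(v) y(w))`. -/
def pluckerFormAux : V →ₗ[ℂ] V [⋀^Fin 1]→ₗ[ℂ] MvPolynomial (Fin n ⊕ Fin n) ℂ where
  toFun v := AlternatingMap.ofSubsingleton ℂ V _ (0 : Fin 1)
    (LinearMap.mulLeft ℂ (genericForm e Sum.inl v) ∘ₗ genericForm e Sum.inr)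
  map_add' v w := by
    ext x
    simp [add_mul]
  map_smul' c v := by
    ext x
    simp

/-- The generic decomposable form `v ∧ w ↦ x(v) y(w) - x(w) y(v)`. -/
def pluckerForm : ⋀[ℂ]^2 V →ₗ[ℂ] MvPolynomial (Fin n ⊕ Fin n) ℂ :=
  exteriorPower.alternatingMapLinearEquiv
    (AlternatingMap.alternatizeUncurryFin (pluckerFormAux e))

theorem pluckerForm_ιMulti (v : Fin 2 → V) :
    pluckerForm e (exteriorPower.ιMulti ℂ 2 v) =
      genericForm e Sum.inl (v 0) * genericForm e Sum.inr (v 1) -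
      genericForm e Sum.inl (v 1) * genericForm e Sum.inr (v 0) := by
  simp [pluckerForm, AlternatingMap.alternatizeUncurryFin_apply, pluckerFormAux,
    Fin.removeNth, sub_eq_add_neg]

/-- The homogeneous coordinate ring of the Grassmannian of lines, as the algebra generated by the
`2 × 2` minors of a generic `2 × n` matrix. -/
def pluckerAlgebra : Subalgebra ℂ (MvPolynomial (Fin n ⊕ Fin n) ℂ) :=
  Algebra.adjoin ℂ (Set.range (pluckerForm e))

/-- The generators of the Plücker algebra. -/
def pluckerGenerator : ⋀[ℂ]^2 V →ₗ[ℂ] pluckerAlgebra e :=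
  (pluckerForm e).codRestrict (Subalgebra.toSubmodule (pluckerAlgebra e))
    fun w => Algebra.subset_adjoin ⟨w, rfl⟩

theorem coe_pluckerGenerator (w : ⋀[ℂ]^2 V) :
    (pluckerGenerator e w : MvPolynomial (Fin n ⊕ Fin n) ℂ) = pluckerForm e w := rfl

instance finiteType_pluckerAlgebra : Algebra.FiniteType ℂ (pluckerAlgebra e) := by
  have : FiniteDimensional ℂ V := e.finiteDimensional_of_finite
  rw [← Subalgebra.fg_iff_finiteType]
  obtain ⟨s, hs⟩ := (Module.Finite.iff_fg.mp
    (inferInstance : Module.Finite ℂ (LinearMap.range (pluckerForm e))))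
  refine ⟨s, ?_⟩
  rw [pluckerAlgebra, ← LinearMap.coe_range, ← hs, Algebra.adjoin_span]

theorem pluckerGenerator_relation (v : Fin 4 → V) :
    pluckerGenerator e (exteriorPower.ιMulti ℂ 2 ![v 0, v 1]) *
        pluckerGenerator e (exteriorPower.ιMulti ℂ 2 ![v 2, v 3]) =
      pluckerGenerator e (exteriorPower.ιMulti ℂ 2 ![v 0, v 2]) *
        pluckerGenerator e (exteriorPower.ιMulti ℂ 2 ![v 1, v 3]) -
      pluckerGenerator e (exteriorPower.ιMulti ℂ 2 ![v 0, v 3]) *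
        pluckerGenerator e (exteriorPower.ιMulti ℂ 2 ![v 1, v 2]) := by
  refine Subtype.ext ?_
  simp only [Subalgebra.coe_mul, Subalgebra.coe_sub, coe_pluckerGenerator, pluckerForm_ιMulti,
    Matrix.cons_val_zero, Matrix.cons_val_one]
  ring

/-- The points of the Plücker algebra are decomposable forms; if the resonance variety of `K` is
trivial, then the only one vanishing on `K` is zero. -/
theorem algHom_pluckerGenerator_eq_zero {K : Submodule ℂ (⋀[ℂ]^2 V)}
    (hK : resonance V K = {0}) (φ : pluckerAlgebra e →ₐ[ℂ] ℂ)
    (hφ : ∀ k ∈ K, φ (pluckerGenerator e k) = 0) (w : ⋀[ℂ]^2 V) :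
    φ (pluckerGenerator e w) = 0 := by
  let f : Module.Dual ℂ (⋀[ℂ]^2 V) := φ.toLinearMap ∘ₗ pluckerGenerator e
  suffices h : f = 0 from LinearMap.congr_fun h w
  by_contra hf
  obtain ⟨v, hv⟩ : ∃ v, f (exteriorPower.ιMulti ℂ 2 v) ≠ 0 := by
    by_contra! hcon
    exact hf (exteriorPower.linearMap_ext (AlternatingMap.ext hcon))
  have hv2 : v = ![v 0, v 1] := by ext i; fin_cases i <;> rfl
  -- With `f(v₀ ∧ v₁) ≠ 0`, the Plücker relation on `v₀, v₁, u₀, u₁` exhibits `f` as `f(v₀, ·) ∧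
  -- f(v₁, ·)` divided by `f(v₀ ∧ v₁)`.
  refine hf (eq_zero_of_resonance_eq hK f hφ
    ((f (exteriorPower.ιMulti ℂ 2 v))⁻¹ • contractLeft f (v 0)) (contractLeft f (v 1))
    fun u => ?_)
  have hu2 : u = ![u 0, u 1] := by ext i; fin_cases i <;> rfl
  have hrel := congrArg φ (pluckerGenerator_relation e ![v 0, v 1, u 0, u 1])
  simp only [Matrix.cons_val, map_mul, map_sub] at hrel
  rw [← hv2, ← hu2] at hrel
  change f _ * f _ = f _ * f _ - f _ * f _ at hrel
  simp only [LinearMap.smul_apply, contractLeft_apply, smul_eq_mul]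
  field_simp
  linear_combination hrel

/-- Setting the variables `x_k` with `k ≥ i` and `y_k` with `k ≥ j` to zero. -/
def truncation (n i j : ℕ) :
    MvPolynomial (Fin n ⊕ Fin n) ℂ →ₐ[ℂ] MvPolynomial (Fin n ⊕ Fin n) ℂ :=
  MvPolynomial.aeval (Sum.elim
    (fun k => if (k : ℕ) < i then MvPolynomial.X (Sum.inl k) else 0)
    (fun k => if (k : ℕ) < j then MvPolynomial.X (Sum.inr k) else 0))

theorem truncation_X_inl (i j : ℕ) (k : Fin n) : truncation n i j (MvPolynomial.X (Sum.inl k)) =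
    if (k : ℕ) < i then MvPolynomial.X (Sum.inl k) else 0 := by
  simp [truncation]

theorem truncation_X_inr (i j : ℕ) (k : Fin n) : truncation n i j (MvPolynomial.X (Sum.inr k)) =
    if (k : ℕ) < j then MvPolynomial.X (Sum.inr k) else 0 := by
  simp [truncation]

theorem truncation_comp_truncation {i j i' j' : ℕ} (hi : i' ≤ i) (hj : j' ≤ j) :
    (truncation n i' j').comp (truncation n i j) = truncation n i' j' := by
  refine MvPolynomial.algHom_ext fun x => ?_
  rcases x with k | k
  · rw [AlgHom.comp_apply, truncation_X_inl, truncation_X_inl]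
    split_ifs with h1 h2 h2
    · rw [truncation_X_inl, if_pos h2]
    · rw [truncation_X_inl, if_neg h2]
    · omega
    · rw [map_zero]
  · rw [AlgHom.comp_apply, truncation_X_inr, truncation_X_inr]
    split_ifs with h1 h2 h2
    · rw [truncation_X_inr, if_pos h2]
    · rw [truncation_X_inr, if_neg h2]
    · omega
    · rw [map_zero]

/-- The prime ideals of the Schubert varieties of the Grassmannian of lines. -/
def schubertIdeal (i j : ℕ) : Ideal (pluckerAlgebra e) :=
  RingHom.ker ((truncation n i j).comp (pluckerAlgebra e).val)

instance isPrime_schubertIdeal (i j : ℕ) : (schubertIdeal e i j).IsPrime :=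
  RingHom.ker_isPrime _

theorem mem_schubertIdeal {i j : ℕ} {r : pluckerAlgebra e} :
    r ∈ schubertIdeal e i j ↔ truncation n i j r = 0 := Iff.rfl

theorem schubertIdeal_mono {i j i' j' : ℕ} (hi : i' ≤ i) (hj : j' ≤ j) :
    schubertIdeal e i j ≤ schubertIdeal e i' j' := by
  intro r hr
  rw [mem_schubertIdeal] at hr ⊢
  rw [← truncation_comp_truncation hi hj, AlgHom.comp_apply, hr, map_zero]

/-- The minor on columns `i - 1, j - 1` separates the two primes: truncation at `(i, j)` leaves
`x_{i-1} y_{j-1}`, and any further truncation kills it. -/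
theorem schubertIdeal_lt {i j i' j' : ℕ} (hi1 : 1 ≤ i) (hij : i < j) (hjn : j ≤ n)
    (hi : i' ≤ i) (hj : j' ≤ j) (hne : i' + j' < i + j) :
    schubertIdeal e i j < schubertIdeal e i' j' := by
  refine lt_of_le_not_ge (schubertIdeal_mono e hi hj) fun hle => ?_
  let k : Fin n := ⟨i - 1, by omega⟩
  let l : Fin n := ⟨j - 1, by omega⟩
  have htr : ∀ a b, truncation n a b (pluckerGenerator e
      (exteriorPower.ιMulti ℂ 2 ![e k, e l]) : MvPolynomial (Fin n ⊕ Fin n) ℂ) =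
      (if i - 1 < a then MvPolynomial.X (Sum.inl k) else 0) *
        (if j - 1 < b then MvPolynomial.X (Sum.inr l) else 0) -
      (if j - 1 < a then MvPolynomial.X (Sum.inl l) else 0) *
        (if i - 1 < b then MvPolynomial.X (Sum.inr k) else 0) := by
    intro a b
    simp only [coe_pluckerGenerator, pluckerForm_ιMulti, Matrix.cons_val_zero,
      Matrix.cons_val_one, genericForm_basis, map_sub, map_mul, truncation_X_inl,
      truncation_X_inr, k, l]
  have hmem : pluckerGenerator e (exteriorPower.ιMulti ℂ 2 ![e k, e l]) ∈
      schubertIdeal e i' j' := by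
    rw [mem_schubertIdeal, htr, if_neg (show ¬ j - 1 < i' by omega), zero_mul, sub_zero]
    rcases hi.lt_or_eq with h | h
    · rw [if_neg (show ¬ i - 1 < i' by omega), zero_mul]
    · rw [if_neg (show ¬ j - 1 < j' by omega), mul_zero]
  have := hle hmem
  rw [mem_schubertIdeal, htr, if_neg (show ¬ j - 1 < i by omega), zero_mul, sub_zero,
    if_pos (by omega), if_pos (by omega)] at this
  exact mul_ne_zero (MvPolynomial.X_ne_zero _) (MvPolynomial.X_ne_zero _) this

/-- The chain raises `j` up to `n`, then `i` up to `n - 1`; each unit step is a strict inclusion of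
primes, so `N` is the number of steps from `(i, j)` to `(n - 1, n)`. -/
theorem le_height_schubertIdeal (N : ℕ) : ∀ i j : ℕ, 1 ≤ i → i < j → j ≤ n →
    i + j + N + 1 = 2 * n → (N : ℕ∞) ≤ (schubertIdeal e i j).height := by
  induction N with
  | zero => simp
  | succ N ih =>
    intro i j hi hij hjn hN
    rw [Nat.cast_succ]
    rcases hjn.lt_or_eq with h | h
    · refine le_trans (add_le_add_left (ih i (j + 1) hi (by omega) h (by omega)) 1)
        (Ideal.height_add_one_le_of_lt_of_isPrime
          (schubertIdeal_lt e hi (by omega) h le_rfl (by omega) (by omega)))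
    · refine le_trans (add_le_add_left (ih (i + 1) j (by omega) (by omega) hjn (by omega)) 1)
        (Ideal.height_add_one_le_of_lt_of_isPrime
          (schubertIdeal_lt e (by omega) (by omega) hjn (by omega) le_rfl (by omega)))

theorem le_height_irrelevantIdeal (hn : 2 ≤ n) :
    ((2 * n - 3 : ℕ) : ℕ∞) ≤ (schubertIdeal e 0 0).height := by
  have h := le_height_schubertIdeal e (2 * n - 4) 1 2 le_rfl (by omega) hn (by omega)
  -- The passage from `(1, 2)` to `(0, 0)` counts only once: at `(1, 2)` only the minor `x₀ y₁`
  -- survives, so the variety is a line.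
  have h2 := Ideal.height_add_one_le_of_lt_of_isPrime
    (schubertIdeal_lt e (i := 1) (j := 2) (i' := 0) (j' := 0) le_rfl (by omega) hn
      (by omega) (by omega) (by omega))
  have h3 : 2 * n - 3 = (2 * n - 4) + 1 := by omega
  rw [h3, Nat.cast_succ]
  exact (add_le_add_left h 1).trans h2

theorem truncation_zero_pluckerForm (w : ⋀[ℂ]^2 V) : truncation n 0 0 (pluckerForm e w) = 0 := by
  have : (truncation n 0 0).toLinearMap ∘ₗ pluckerForm e = 0 := by
    refine exteriorPower.linearMap_ext (AlternatingMap.ext fun v => ?_)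
    have hX : ∀ f v, truncation n 0 0 (genericForm e f v) = 0 := by
      intro f v
      have : (truncation n 0 0).toLinearMap ∘ₗ genericForm e f = 0 := e.ext fun i => by
        rw [LinearMap.comp_apply, genericForm_basis]
        simp [truncation]
      exact LinearMap.congr_fun this v
    simp [pluckerForm_ιMulti, hX]
  exact LinearMap.congr_fun this w

/-- A point killing all generators takes the constant term, as does truncation at `(0, 0)`. -/
theorem ker_eq_irrelevantIdeal (φ : pluckerAlgebra e →ₐ[ℂ] ℂ)
    (hφ : ∀ w, φ (pluckerGenerator e w) = 0) : RingHom.ker φ = schubertIdeal e 0 0 := by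
  have h : ∀ r : pluckerAlgebra e, truncation n 0 0 (r : MvPolynomial (Fin n ⊕ Fin n) ℂ) =
      algebraMap ℂ _ (φ r) := by
    rintro ⟨r, hr⟩
    induction hr using Algebra.adjoin_induction with
    | mem x hx =>
      obtain ⟨w, rfl⟩ := hx
      have h1 : φ ⟨pluckerForm e w, Algebra.subset_adjoin ⟨w, rfl⟩⟩ = 0 := hφ w
      rw [truncation_zero_pluckerForm, h1, map_zero]
    | algebraMap c =>
      rw [AlgHom.commutes]
      exact congrArg _ (φ.commutes c).symm
    | add x y hx hy hx' hy' =>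
      rw [map_add, hx', hy', ← map_add, ← map_add]
      rfl
    | mul x y hx hy hx' hy' =>
      rw [map_mul, hx', hy', ← map_mul, ← map_mul]
      rfl
  ext r
  rw [mem_schubertIdeal, h, RingHom.mem_ker]
  exact (map_eq_zero (algebraMap ℂ (MvPolynomial (Fin n ⊕ Fin n) ℂ))).symm

/-- If the resonance variety of an `m`-plane is trivial, then Krull's height theorem bounds the
height of the irrelevant ideal of the Plücker algebra by `m`. -/
theorem height_irrelevantIdeal_le {m : ℕ} {K : Grass (⋀[ℂ]^2 V) m}
    (hK : resonance V K.plane = {0}) : (schubertIdeal e 0 0).height ≤ m := by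
  have : IsNoetherianRing (pluckerAlgebra e) := Algebra.FiniteType.isNoetherianRing ℂ _
  have : IsJacobsonRing (pluckerAlgebra e) := isJacobsonRing_of_finiteType (A := ℂ)
  let S : Set (pluckerAlgebra e) :=
    Set.range fun i => pluckerGenerator e (K.basis i : ⋀[ℂ]^2 V)
  have hvanish : ∀ φ : pluckerAlgebra e →ₐ[ℂ] ℂ, (∀ s ∈ S, φ s = 0) →
      ∀ k ∈ K.plane, φ (pluckerGenerator e k) = 0 := by
    intro φ hφ k hk
    have : (φ.toLinearMap ∘ₗ pluckerGenerator e) ∘ₗ K.plane.subtype = 0 :=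
      K.basis.ext fun i => hφ _ ⟨i, rfl⟩
    exact LinearMap.congr_fun this ⟨k, hk⟩
  have hmax : ∀ P : Ideal (pluckerAlgebra e), P.IsMaximal → Ideal.span S ≤ P →
      P = schubertIdeal e 0 0 := by
    intro P hP hSP
    obtain ⟨φ, rfl⟩ := exists_algHom_ker_eq P
    exact ker_eq_irrelevantIdeal e φ (algHom_pluckerGenerator_eq_zero e hK φ
      (hvanish φ fun s hs => hSP (Ideal.subset_span hs)))
  -- In a Jacobson ring a prime is the intersection of the maximal ideals above it, and here only
  -- the irrelevant ideal can occur.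
  have hjac : ∀ P : Ideal (pluckerAlgebra e), P.IsPrime → Ideal.span S ≤ P →
      schubertIdeal e 0 0 ≤ P := by
    intro P hP hSP
    rw [← hP.isRadical.radical, Ideal.radical_eq_jacobson, Ideal.jacobson]
    exact le_sInf fun M hM => (hmax M hM.2 (hSP.trans hM.1)).ge
  have hmem : Ideal.span S ≤ schubertIdeal e 0 0 := by
    rw [Ideal.span_le]
    rintro _ ⟨i, rfl⟩
    rw [SetLike.mem_coe, mem_schubertIdeal, coe_pluckerGenerator, truncation_zero_pluckerForm]
  have hmin : schubertIdeal e 0 0 ∈ (Ideal.span S).minimalPrimes :=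
    ⟨⟨inferInstance, hmem⟩, fun P hP _ => hjac P hP.1 hP.2⟩
  refine (Ideal.height_le_card_of_mem_minimalPrimes_span (Set.finite_range _) hmin).trans ?_
  rw [← Set.image_univ]
  exact_mod_cast (Set.ncard_image_le Set.finite_univ).trans (by simp [Set.ncard_univ])

theorem le_of_vanishingLocus_nonempty [FiniteDimensional ℂ V] {m : ℕ}
    (h : (vanishingLocus V m).Nonempty) : 2 * Module.finrank ℂ V - 3 ≤ m := by
  obtain ⟨K, hK⟩ := h
  rcases lt_or_ge (Module.finrank ℂ V) 2 with hn | hn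
  -- For `n < 2` the truncated difference `2n - 3` is zero.
  · omega
  · exact_mod_cast (le_height_irrelevantIdeal (Module.finBasis ℂ V) hn).trans
      (height_irrelevantIdeal_le (Module.finBasis ℂ V) hK)

end PluckerAlgebra

end KoszulResonance

end

/-! ### The theorem -/

open KoszulResonance in
theorem theorem1p1 (n m : ℕ) (hn : 1 ≤ n) (hm : m ≤ n.choose 2) :
    (∀ (V : Type u) [AddCommGroup V] [Module ℂ V] [FiniteDimensional ℂ V],
      Module.finrank ℂ V = n →
        IsOpen (vanishingLocus V m) ∧
        ((vanishingLocus V m).Nonempty ↔ 2 * (n : ℤ) - 3 ≤ (m : ℤ))) ∧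
    (2 * (n : ℤ) - 3 ≤ (m : ℤ) →
      ∃ q : ℕ, ∀ (V : Type u) [AddCommGroup V] [Module ℂ V] [FiniteDimensional ℂ V],
        Module.finrank ℂ V = n →
          ∀ K ∈ vanishingLocus V m, koszulPiece V K.plane q = ⊥) := by
  refine ⟨fun V _ _ _ hV => ⟨isOpen_vanishingLocus m, ?_, ?_⟩, fun _ =>
    exists_forall_koszulPiece_eq_bot n m⟩
  · intro h
    have := le_of_vanishingLocus_nonempty h
    omega
  · intro h
    exact vanishingLocus_nonempty (by rwa [hV]) (by omega)
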